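/- Let $d\ge 1$, let $(M_1,g_1)$ and $(M_2,g_2)$ be smooth oriented $d$-dimensional Riemannian manifolds, possibly with boundary, and let $f:M_1\to M_2$ be a $C^2$ local diffeomorphism. Let $\operatorname{Cof} df\in\Omega^1(M_1;f^*TM_2)$ be the cofactor of the differential of $f$, $$\operatorname{Cof} df=(-1)^{d-1}\,\star^{d-1}_{TM_2}\circ\textstyle\bigwedge^{d-1}df\circ\star^{1}_{TM_1},$$ where $\star^k$ is the Hodge dual on $k$-vectors of the oriented inner product spaces $T_xM_i$, and let $\nabla^{f^*TM_2}$ be the pullback to $f^*TM_2$ of the Levi-Civita connection of $M_2$. Let $\delta_{\nabla^{f^*TM_2}}$ be the coderivative, i.e. the adjoint of $\nabla^{f^*TM_2}$ with respect to compactly supported sections: for $\omega\in\Omega^1(M_1;f^*TM_2)$ of class $C^1$, $\delta_{\nabla^{f^*TM_2}}\omega$ is the unique continuous section of $f^*TM_2$ with $\int_{M_1}\langle\sigma,\delta_{\nabla^{f^*TM_2}}\omega\rangle\,d\mathrm{Vol}_1=\int_{M_1}\langle\nabla^{f^*TM_2}\sigma,\omega\rangle\,d\mathrm{Vol}_1$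 for every $C^1$ section $\sigma$ of $f^*TM_2$ with compact support in the interior of $M_1$; equivalently $\delta_{\nabla^{f^*TM_2}}\omega=-\sum_{i=1}^d(\nabla_{e_i}\omega)(e_i)$ for orthonormal bases $(e_i)$ of the tangent spaces of $M_1$, where $\nabla$ is induced by the Levi-Civita connection of $M_1$ and $\nabla^{f^*TM_2}$. Then the Riemannian Piola identity holds on all of $M_1$: $$\delta_{\nabla^{f^*TM_2}}\operatorname{Cof} df=0,$$ both for the adjoint and for the trace expression of the coderivative. Equivalently, for every $C^1$ section $\xi$ of $f^*TM_2$ with compact support in the interior of $M_1$, the function $\langle\operatorname{Cof} df,\nabla^{f^*TM_2}\xi\rangle_{g_1,g_2}$ is integrable and $$\int_{M_1}\langle\operatorname{Cof} df,\nabla^{f^*TM_2}\xi\rangle_{g_1,g_2}\,d\mathrm{Vol}_1=0,$$ where $\langle\cdot,\cdot\rangle_{g_1,g_2}$ is the inner product induced on $T^*M_1\otimes f^*TM_2$. -/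

import Mathlib

open Bundle Manifold MeasureTheory Module
open scoped ContDiff Topology ExteriorAlgebra

noncomputable section

namespace RiemannianPiola

/-! ### Linear algebra: Hodge dual and cofactor -/

section LinearAlgebra

variable {d : ℕ}
  {V : Type*} [NormedAddCommGroup V] [InnerProductSpace ℝ V] [Fact (finrank ℝ V = d)]
  [FiniteDimensional ℝ V]
  {W : Type*} [NormedAddCommGroup W] [InnerProductSpace ℝ W] [Fact (finrank ℝ W = d)]
  [FiniteDimensional ℝ W]

/-- The unit volume form of an oriented `d`-dimensional inner product space, as a linear functional
on the exterior algebra: `v₁ ∧ ⋯ ∧ v_d ↦ Vol(v₁, …, v_d)`, and zero in all degrees other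
than `d`. -/
def volFunctional (o : Orientation ℝ V (Fin d)) : ExteriorAlgebra ℝ V →ₗ[ℝ] ℝ :=
  ExteriorAlgebra.liftAlternating (Pi.single d o.volumeForm)

/-- The Hodge dual `⋆ᵏ : ⋀ᵏ V → ⋀ˡ V` on multivectors, of interest for `k + l = d`. It is
characterized by `γ ∧ ⋆β = ⟨γ, β⟩ Vol`, equivalently by `⟨⋆β, γ⟩ = Vol(β ∧ γ)`. The definition
expands `⋆β` in the orthonormal basis `e_J = e_{j₁} ∧ ⋯ ∧ e_{jₗ}`, `j₁ < ⋯ < jₗ`, of `⋀ˡ V` that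
comes from an orthonormal basis `e` of `V`:  `⋆β = ∑_J Vol(β ∧ e_J) e_J`. -/
def hodgeStar (o : Orientation ℝ V (Fin d)) (k l : ℕ) : (⋀[ℝ]^k V) →ₗ[ℝ] (⋀[ℝ]^l V) :=
  ∑ J : Fin l ↪o Fin (finrank ℝ V),
    (volFunctional o ∘ₗ
      LinearMap.mulRight ℝ (ExteriorAlgebra.ιMulti ℝ l (fun i ↦ stdOrthonormalBasis ℝ V (J i))) ∘ₗ
      (⋀[ℝ]^k V).subtype).smulRight
    (exteriorPower.ιMulti ℝ l (fun i ↦ stdOrthonormalBasis ℝ V (J i)))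

/-- The intrinsic cofactor `Cof A = (-1)^(d-1) ⋆_W^{d-1} ∘ ⋀^{d-1} A ∘ ⋆_V^1` of a linear map
between oriented `d`-dimensional inner product spaces, with `⋀¹ V = V` and `⋀¹ W = W`. -/
def cof (oV : Orientation ℝ V (Fin d)) (oW : Orientation ℝ W (Fin d)) (A : V →ₗ[ℝ] W) :
    V →ₗ[ℝ] W :=
  (-1 : ℝ) ^ (d - 1) •
    ((exteriorPower.oneEquiv (R := ℝ) (M := W)).toLinearMap ∘ₗ hodgeStar oW (d - 1) 1 ∘ₗ
      exteriorPower.map (d - 1) A ∘ₗ hodgeStar oV 1 (d - 1) ∘ₗ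
      (exteriorPower.oneEquiv (R := ℝ) (M := V)).symm.toLinearMap)

/-- The inner product of `V^* ⊗ W = Hom(V, W)`: `⟨A, B⟩ = ∑ᵢ ⟨A eᵢ, B eᵢ⟩` for an orthonormal basis
`e` of `V`. -/
def innerHom (A B : V → W) : ℝ :=
  ∑ i, inner ℝ (A (stdOrthonormalBasis ℝ V i)) (B (stdOrthonormalBasis ℝ V i))

end LinearAlgebra

/-! ### Manifolds -/

section Manifold

variable {d : ℕ} {H : Type*} [TopologicalSpace H]
  {I : ModelWithCorners ℝ (EuclideanSpace ℝ (Fin d)) H}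

instance finiteDimensional_tangentSpace {M : Type*} [TopologicalSpace M] [ChartedSpace H M]
    (x : M) : FiniteDimensional ℝ (TangentSpace I x) :=
  inferInstanceAs (FiniteDimensional ℝ (EuclideanSpace ℝ (Fin d)))

instance fact_finrank_tangentSpace {M : Type*} [TopologicalSpace M] [ChartedSpace H M]
    (x : M) : Fact (finrank ℝ (TangentSpace I x) = d) :=
  ⟨(finrank_euclideanSpace_fin : finrank ℝ (EuclideanSpace ℝ (Fin d)) = d)⟩

variable (I) in
/-- An orientation of a `d`-dimensional manifold: an orientation of every tangent space that is
locally constant in the coordinates given by charts. -/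
structure ManifoldOrientation (M : Type*) [TopologicalSpace M] [ChartedSpace H M]
    [IsManifold I ∞ M] where
  /-- the orientation of the tangent space at a point -/
  at' : ∀ x : M, Orientation ℝ (TangentSpace I x) (Fin d)
  locallyConstant : ∀ x₀ : M, ∀ᶠ x in 𝓝 x₀,
    ∀ hx : x ∈ (trivializationAt (EuclideanSpace ℝ (Fin d)) (TangentSpace I) x₀).baseSet,
      Orientation.map (Fin d)
          ((trivializationAt (EuclideanSpace ℝ (Fin d)) (TangentSpace I) x₀).linearEquivAt ℝ x hx)
          (at' x) =
        Orientation.map (Fin d)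
          ((trivializationAt (EuclideanSpace ℝ (Fin d)) (TangentSpace I) x₀).linearEquivAt ℝ x₀
            (mem_baseSet_trivializationAt (EuclideanSpace ℝ (Fin d)) (TangentSpace I) x₀))
          (at' x₀)

variable {M : Type*} [TopologicalSpace M] [ChartedSpace H M] [IsManifold I ∞ M]

variable (I) in
/-- The coordinate vector field `∑ uⁱ ∂ᵢ` of the preferred chart at `q`, with constant
coefficients `u` (used only at points `x` of the domain of that chart). -/
def coordField (q : M) (u : EuclideanSpace ℝ (Fin d)) (x : M) : TangentSpace I x :=
  (trivializationAt (EuclideanSpace ℝ (Fin d)) (TangentSpace I) q).symmL ℝ x u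

variable [RiemannianBundle (fun x : M ↦ TangentSpace I x)]

variable (I) in
/-- `∂_w ⟨X_u, X_v⟩` at `q`, for the coordinate vector fields `X_u`, `X_v` of the chart at `q`. -/
def metricDeriv (q : M) (w u v : TangentSpace I q) : ℝ :=
  mfderiv I 𝓘(ℝ, ℝ) (fun x : M ↦ inner ℝ (coordField I q u x) (coordField I q v x)) q w

variable (I) in
/-- The Christoffel symbol `Γ(u, v)` of the Levi-Civita connection at `q`, in the preferred chart
at `q`:  `⟨Γ(u, v), w⟩ = ½ (∂_u ⟨X_v, X_w⟩ + ∂_v ⟨X_u, X_w⟩ - ∂_w ⟨X_u, X_v⟩)`,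
with the index raised by means of an orthonormal basis of the tangent space. -/
def christoffel (q : M) (u v : TangentSpace I q) : TangentSpace I q :=
  ∑ i, ((1 / 2 : ℝ) *
      (metricDeriv I q u v (stdOrthonormalBasis ℝ (TangentSpace I q) i)
        + metricDeriv I q v u (stdOrthonormalBasis ℝ (TangentSpace I q) i)
        - metricDeriv I q (stdOrthonormalBasis ℝ (TangentSpace I q) i) u v)) •
    stdOrthonormalBasis ℝ (TangentSpace I q) i

variable (I) in
/-- The matrix `⟨∂ᵢ, ∂ⱼ⟩` of the metric in the preferred chart at `q`, as a function on the image of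
that chart. -/
def gramMatrix (q : M) (y : EuclideanSpace ℝ (Fin d)) : Matrix (Fin d) (Fin d) ℝ :=
  Matrix.of fun i j ↦
    inner ℝ (coordField I q (EuclideanSpace.single i 1) ((extChartAt I q).symm y))
      (coordField I q (EuclideanSpace.single j 1) ((extChartAt I q).symm y))

variable (I) in
/-- The Riemannian volume measure of the domain of the preferred chart at `q`: the image under the
inverse chart of `√(det g) dy`. -/
def chartVolume [MeasurableSpace M] (q : M) : Measure M :=
  Measure.map (extChartAt I q).symm
    (((volume : Measure (EuclideanSpace ℝ (Fin d))).restrict (extChartAt I q).target).withDensity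
      fun y ↦ ENNReal.ofReal (Real.sqrt (gramMatrix I q y).det))

variable (I M) in
/-- The Riemannian volume measure `dVol`: the measure whose restriction to the domain of every
chart is the chart's `√(det g) dy`. As these local measures agree on overlaps, it is their
supremum. -/
def riemannianVolume [MeasurableSpace M] : Measure M := ⨆ q : M, chartVolume I q

end Manifold

/-! ### Sections along a map and the pullback connection -/

section Along

variable {d : ℕ} {H : Type*} [TopologicalSpace H]
  {I : ModelWithCorners ℝ (EuclideanSpace ℝ (Fin d)) H}
  {M₁ : Type*} [TopologicalSpace M₁] [ChartedSpace H M₁] [IsManifold I ∞ M₁]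
  [RiemannianBundle (fun x : M₁ ↦ TangentSpace I x)]
  {M₂ : Type*} [TopologicalSpace M₂] [ChartedSpace H M₂] [IsManifold I ∞ M₂]
  [RiemannianBundle (fun x : M₂ ↦ TangentSpace I x)]

variable (I) in
/-- The covariant derivative `∇_v^{f^*TM₂} ξ` at `p` of a section `ξ` of `f^*TM₂`, for the pullback
of the Levi-Civita connection of `M₂`: in the chart of `M₂` at `f p` it is
`∂_v ξ^β + Γ^β_{γδ} (df v)^γ ξ^δ`. -/
def covDerivAlong (f : M₁ → M₂) (ξ : ∀ x, TangentSpace I (f x)) (p : M₁)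
    (v : TangentSpace I p) : TangentSpace I (f p) :=
  (trivializationAt (EuclideanSpace ℝ (Fin d)) (TangentSpace I) (f p)).symmL ℝ (f p)
      (mfderiv I 𝓘(ℝ, EuclideanSpace ℝ (Fin d))
        (fun x ↦ (trivializationAt (EuclideanSpace ℝ (Fin d)) (TangentSpace I)
          (f p)).continuousLinearMapAt ℝ (f x) (ξ x)) p v)
    + christoffel I (f p) (mfderiv I I f p v) (ξ p)

variable (I) in
/-- The covariant derivative `(∇_v α)(u)` at `p` of `α ∈ Ω¹(M₁; f^*TM₂)`, for the connection induced
by the Levi-Civita connection of `M₁` and the pullback connection: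
`(∇_v α)(U) = ∇_v (α(U)) - α(∇_v U)`, where `U` is the coordinate field with `U(p) = u` and the
Levi-Civita connection of `M₁` is the pullback connection along the identity. -/
def covDerivForm (f : M₁ → M₂) (α : ∀ x, TangentSpace I x →ₗ[ℝ] TangentSpace I (f x))
    (p : M₁) (v u : TangentSpace I p) : TangentSpace I (f p) :=
  covDerivAlong I f (fun x ↦ α x (coordField I p u x)) p v
    - α p (covDerivAlong I (fun x : M₁ ↦ x) (coordField I p u) p v)

variable (I) in
/-- The coderivative `δα = -tr_g (∇α) = -∑ᵢ (∇_{eᵢ} α)(eᵢ)` of `α ∈ Ω¹(M₁; f^*TM₂)`, for an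
orthonormal basis `e` of the tangent space. -/
def coderivative (f : M₁ → M₂) (α : ∀ x, TangentSpace I x →ₗ[ℝ] TangentSpace I (f x))
    (p : M₁) : TangentSpace I (f p) :=
  -∑ i, covDerivForm I f α p (stdOrthonormalBasis ℝ (TangentSpace I p) i)
      (stdOrthonormalBasis ℝ (TangentSpace I p) i)

variable (I) in
/-- `ξ` is a `C^1` section of `f^*TM₂`, compactly supported in the interior of `M₁`. -/
structure IsTestSection (f : M₁ → M₂) (ξ : ∀ x, TangentSpace I (f x)) : Prop where
  contMDiff : ContMDiff I I.tangent 1 (fun x ↦ (⟨f x, ξ x⟩ : TangentBundle I M₂))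
  compactSupport : ∃ K : Set M₁, IsCompact K ∧ K ⊆ I.interior M₁ ∧ ∀ x ∉ K, ξ x = 0

variable (I) in
/-- The section `η` of `f^*TM₂` is the coderivative of `α` in the sense that it represents the
adjoint of the pullback connection: `∫ ⟨σ, η⟩ dVol = ∫ ⟨∇σ, α⟩ dVol` for all test sections `σ`. -/
def IsAdjointCoderivative [MeasurableSpace M₁] (f : M₁ → M₂)
    (α : ∀ x, TangentSpace I x →ₗ[ℝ] TangentSpace I (f x)) (η : ∀ x, TangentSpace I (f x)) :
    Prop :=
  ∀ σ : ∀ x, TangentSpace I (f x), IsTestSection I f σ →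
    ∫ x, inner ℝ (σ x) (η x) ∂(riemannianVolume I M₁) =
      ∫ x, innerHom (covDerivAlong I f σ x) (α x) ∂(riemannianVolume I M₁)

/-- The cofactor `Cof df ∈ Ω¹(M₁; f^*TM₂)` of the differential of `f`. -/
def cofDifferential (o₁ : ManifoldOrientation I M₁) (o₂ : ManifoldOrientation I M₂) (f : M₁ → M₂)
    (x : M₁) : TangentSpace I x →ₗ[ℝ] TangentSpace I (f x) :=
  cof (o₁.at' x) (o₂.at' (f x)) (mfderiv I I f x : TangentSpace I x →ₗ[ℝ] TangentSpace I (f x))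

end Along

end RiemannianPiola

end

noncomputable section

namespace RiemannianPiola

/-! ### The cofactor of a linear map -/

section Cofactor

set_option linter.unusedSectionVars false

variable {d : ℕ}
  {V : Type*} [NormedAddCommGroup V] [InnerProductSpace ℝ V] [Fact (finrank ℝ V = d)]
  [FiniteDimensional ℝ V]
  {W : Type*} [NormedAddCommGroup W] [InnerProductSpace ℝ W] [Fact (finrank ℝ W = d)]
  [FiniteDimensional ℝ W]

/-! If A multiplies oriented volume by Det A, then ⟨Cof A v, A w⟩ = Det A ⟨v, w⟩
(`inner_cof_apply`). Hence (Cof df)* = Det(df) df⁻¹, and the Hodge duals play no further role.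

Let ξ be a section of f*TM₂ and W = (Cof df)* ξ. Write ρ₁, ρ₂ for the densities √(det g), F for f in
charts and A = DF. In coordinates, up to a locally constant sign, ρ₁ W = det A · A⁻¹(ρ₂∘F · ξ). This
is the classical Piola transform: in div(det A · A⁻¹ v) the derivatives of A cancel, by Jacobi's
formula and the symmetry of D²F, which leaves det A · tr(A⁻¹ Dv)
(`hasFDerivWithinAt_det_smul_inverse`). The derivative of ρ₂ inside Dv is accounted for by the trace
of the Christoffel symbols (`density_mul_trace_christoffelL`). The result is div W = ⟨Cof df, ∇ξ⟩
(`innerHom_cof_covDerivAlong`).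

Both forms of the identity follow. Pointwise, compatibility of the connections with the metrics
gives ⟨tr ∇(Cof df), ξ⟩ = div W - ⟨Cof df, ∇ξ⟩ = 0. Weakly, ∫ div W = 0 by the divergence theorem
(`integral_chartDiv`) when ξ has compact support in the interior. That the divergence is the same in
all charts is again the Piola computation, now for transition maps (`chartDiv_eq`). The adjoint
coderivative is then pinned down by `eq_zero_of_forall_integral_inner`: bump functions show that it
vanishes in the interior, and density of the interior gives the rest.

Boundary points need no separate treatment in the pointwise part. Derivatives are taken within the
range of the model, every point of which is a limit of interior points of that range, so second
derivatives are still symmetric there. -/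

lemma volFunctional_ιMulti (o : Orientation ℝ V (Fin d)) (v : Fin d → V) :
    volFunctional o (ExteriorAlgebra.ιMulti ℝ d v) = o.volumeForm v := by
  simp [volFunctional]

/-- A linear functional on the exterior algebra is determined by its values on products of vectors.
In degree d the claim is the hypothesis, and in every other degree both sides vanish. -/
lemma volFunctional_comp_map (oV : Orientation ℝ V (Fin d)) (oW : Orientation ℝ W (Fin d))
    {A : V →ₗ[ℝ] W} {c : ℝ} (h : oW.volumeForm.compLinearMap A = c • oV.volumeForm)
    (x : ExteriorAlgebra ℝ V) :
    volFunctional oW (ExteriorAlgebra.map A x) = c * volFunctional oV x := by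
  have : volFunctional oW ∘ₗ (ExteriorAlgebra.map A).toLinearMap = c • volFunctional oV := by
    apply ExteriorAlgebra.lhom_ext
    intro i
    ext v
    by_cases hi : i = d
    · subst hi
      have := congrArg (fun φ ↦ φ v) h
      simpa [volFunctional, ExteriorAlgebra.map_apply_ιMulti, Function.comp_def] using this
    · simp [volFunctional, ExteriorAlgebra.map_apply_ιMulti, Pi.single_eq_of_ne hi]
  simpa using congrArg (fun φ ↦ φ x) this

lemma coe_exteriorPower_map (k : ℕ) (A : V →ₗ[ℝ] W) (x : ⋀[ℝ]^k V) :
    (exteriorPower.map k A x : ExteriorAlgebra ℝ W) = ExteriorAlgebra.map A x := by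
  have : (⋀[ℝ]^k W).subtype ∘ₗ exteriorPower.map k A =
      (ExteriorAlgebra.map A).toLinearMap ∘ₗ (⋀[ℝ]^k V).subtype := by
    ext v
    simp [ExteriorAlgebra.map_apply_ιMulti, exteriorPower.map_apply_ιMulti]
  exact congrArg (fun φ ↦ φ x) this

/-- Contraction of the Hodge dual of a `k`-vector, `k = d - 1`, with a vector. -/
lemma inner_oneEquiv_hodgeStar (o : Orientation ℝ V (Fin d)) (k : ℕ) (β : ⋀[ℝ]^k V) (w : V) :
    inner ℝ (exteriorPower.oneEquiv (R := ℝ) (M := V) (hodgeStar o k 1 β)) w =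
      volFunctional o (β * ExteriorAlgebra.ι ℝ w) := by
  set e := stdOrthonormalBasis ℝ V
  have hι : ∀ u : V, ExteriorAlgebra.ιMulti ℝ 1 (fun _ : Fin 1 ↦ u) = ExteriorAlgebra.ι ℝ u := by
    intro u; simp [ExteriorAlgebra.ιMulti_apply]
  -- The basis of ⋀¹ is indexed by increasing maps out of `Fin 1`, that is, by single indices.
  let E : (Fin 1 ↪o Fin (finrank ℝ V)) ≃ Fin (finrank ℝ V) :=
    { toFun := fun J ↦ J 0
      invFun := fun j ↦ OrderEmbedding.ofStrictMono (fun _ ↦ j) (Subsingleton.strictMono _)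
      left_inv := fun J ↦ by ext i; simp [Subsingleton.elim i 0]
      right_inv := fun j ↦ by simp }
  have h1 : exteriorPower.oneEquiv (R := ℝ) (M := V) (hodgeStar o k 1 β) =
      ∑ j, volFunctional o (β * ExteriorAlgebra.ι ℝ (e j)) • e j := by
    rw [← E.sum_comp]
    simp only [hodgeStar, LinearMap.sum_apply, map_sum, LinearMap.smulRight_apply, map_smul,
      exteriorPower.oneEquiv_ιMulti]
    refine Finset.sum_congr rfl fun J _ ↦ ?_
    have : (fun i ↦ stdOrthonormalBasis ℝ V (J i)) = fun _ : Fin 1 ↦ e (J 0) := by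
      funext i; rw [Subsingleton.elim i 0]
    simp [this, hι, E]
    rfl
  rw [h1, sum_inner]
  conv_rhs => rw [← e.sum_repr' w]
  simp only [map_sum, map_smul, Finset.mul_sum, mul_smul_comm, inner_smul_left, smul_eq_mul]
  simp [mul_comm]

/-- By cardinality J misses some index j, so its range is the complement of j, and a strictly
increasing map out of `Fin n` is determined by its range. -/
lemma exists_eq_succAboveOrderEmb {n : ℕ} (J : Fin n ↪o Fin (n + 1)) :
    ∃ j, J = Fin.succAboveOrderEmb j := by
  obtain ⟨j, hj⟩ : ∃ j, j ∉ Set.range J := by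
    by_contra! h
    have := Fintype.card_le_of_surjective J h
    simp at this
  refine ⟨j, ?_⟩
  have hsub : Set.range J ⊆ Set.range (Fin.succAboveOrderEmb j) := by
    rintro _ ⟨i, rfl⟩
    have : J i ∈ ({j}ᶜ : Set (Fin (n + 1))) := fun h ↦ hj ⟨i, h⟩
    rwa [← Fin.range_succAbove] at this
  have heq : Set.range J = Set.range (Fin.succAboveOrderEmb j) := by
    apply Set.eq_of_subset_of_ncard_le hsub
    rw [Set.ncard_range_of_injective J.injective,
      Set.ncard_range_of_injective (Fin.succAboveOrderEmb j).injective]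
  exact DFunLike.coe_injective ((StrictMono.range_inj J.strictMono
    (Fin.succAboveOrderEmb j).strictMono).1 heq)

/-- This is ⟨⋆v, ⋆w⟩ = ⟨v, w⟩ for vectors. Each e_J omits a single e_j, so v ∧ e_J sees only the
component of v along e_j, up to a sign that disappears in the product. The index bound m stands for
`finrank ℝ V` and is a variable so that it can be substituted. -/
lemma sum_volFunctional_mul_volFunctional (o : Orientation ℝ V (Fin d)) (hd : d ≠ 0) {m : ℕ}
    (hm : m = d) (e : OrthonormalBasis (Fin m) ℝ V) (v w : V) :
    ∑ J : Fin (d - 1) ↪o Fin m,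
      volFunctional o (ExteriorAlgebra.ι ℝ v *
        ExteriorAlgebra.ιMulti ℝ (d - 1) (fun i ↦ e (J i))) *
      volFunctional o (ExteriorAlgebra.ι ℝ w *
        ExteriorAlgebra.ιMulti ℝ (d - 1) (fun i ↦ e (J i))) =
      inner ℝ v w := by
  obtain ⟨n, rfl⟩ := Nat.exists_eq_succ_of_ne_zero hd
  subst hm
  simp only [Nat.succ_eq_add_one, Nat.add_one_sub_one]
  -- Expand u in the basis: a component along e_i with i ≠ j repeats a vector of e_J and contributes
  -- nothing.
  have hvol (u : V) (j : Fin (n + 1)) : volFunctional o (ExteriorAlgebra.ι ℝ u *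
      ExteriorAlgebra.ιMulti ℝ n (fun i ↦ e (Fin.succAboveOrderEmb j i))) =
      inner ℝ (e j) u * o.volumeForm (Fin.cons (e j) fun i ↦ e (j.succAbove i)) := by
    have h1 (u : V) : ExteriorAlgebra.ι ℝ u *
        ExteriorAlgebra.ιMulti ℝ n (fun i ↦ e (Fin.succAboveOrderEmb j i)) =
        ExteriorAlgebra.ιMulti ℝ (n + 1) (Fin.cons u fun i ↦ e (j.succAbove i)) := by
      rw [ExteriorAlgebra.ιMulti_succ_apply]; rfl
    have h2 (i : Fin (n + 1)) (hi : i ≠ j) : volFunctional o (ExteriorAlgebra.ι ℝ (e i) *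
        ExteriorAlgebra.ιMulti ℝ n (fun i ↦ e (Fin.succAboveOrderEmb j i))) = 0 := by
      obtain ⟨k, rfl⟩ := Fin.exists_succAbove_eq hi
      rw [h1, volFunctional_ιMulti]
      exact o.volumeForm.map_eq_zero_of_eq _ (i := 0) (j := k.succ) (by simp)
        (Fin.succ_ne_zero k).symm
    conv_lhs => rw [← e.sum_repr' u]
    simp only [map_sum, map_smul, Finset.sum_mul, smul_mul_assoc, smul_eq_mul]
    rw [Finset.sum_eq_single j (fun i _ hi ↦ by rw [h2 i hi, mul_zero]) (by simp), h1,
      volFunctional_ιMulti]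
  -- The frame with e_j moved to the front is a permuted orthonormal basis, so its volume is ±1.
  have hsq (j : Fin (n + 1)) :
      o.volumeForm (Fin.cons (e j) fun i ↦ e (j.succAbove i)) *
        o.volumeForm (Fin.cons (e j) fun i ↦ e (j.succAbove i)) = 1 := by
    have hinj : Function.Injective (Fin.cons j fun i ↦ j.succAbove i : Fin (n + 1) → Fin (n + 1)) :=
      Fin.cons_injective_iff.2 ⟨by simp, Fin.succAbove_right_injective⟩
    let σ := Equiv.ofBijective _ (Finite.injective_iff_bijective.1 hinj)
    have h := o.abs_volumeForm_apply_of_orthonormal (e.reindex σ.symm)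
    have hcons : ⇑(e.reindex σ.symm) = Fin.cons (e j) fun i ↦ e (j.succAbove i) := by
      funext i
      refine Fin.cases ?_ (fun i ↦ ?_) i <;> simp [σ]
    rw [hcons] at h
    rw [← abs_mul_abs_self, h, one_mul]
  have hbij : Function.Bijective (fun j : Fin (n + 1) ↦ Fin.succAboveOrderEmb j) := by
    refine ⟨fun i j h ↦ ?_, fun J ↦ ?_⟩
    · exact Fin.succAbove_left_injective (congrArg DFunLike.coe h)
    · obtain ⟨j, rfl⟩ := exists_eq_succAboveOrderEmb J
      exact ⟨j, rfl⟩
  rw [← hbij.sum_comp, ← e.sum_inner_mul_inner v w]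
  refine Finset.sum_congr rfl fun j _ ↦ ?_
  rw [hvol, hvol, real_inner_comm (e j) v]
  linear_combination inner ℝ (e j) v * inner ℝ (e j) w * hsq j

/-- Moving w past each of the k factors costs one sign. For k = d - 1 this is the sign that the
definition of `cof` compensates. -/
lemma ι_mul_ιMulti_comm (k : ℕ) (w : V) (u : Fin k → V) :
    ExteriorAlgebra.ιMulti ℝ k u * ExteriorAlgebra.ι ℝ w =
      (-1 : ℝ) ^ k • (ExteriorAlgebra.ι ℝ w * ExteriorAlgebra.ιMulti ℝ k u) := by
  induction k with
  | zero => simp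
  | succ k ih =>
    rw [ExteriorAlgebra.ιMulti_succ_apply, mul_assoc, ih, mul_smul_comm, ← mul_assoc, ← mul_assoc,
      eq_neg_of_add_eq_zero_left (ExteriorAlgebra.ι_add_mul_swap (R := ℝ) (u 0) w), pow_succ]
    simp

/-- The cofactor is characterized by `⟨Cof A v, A w⟩ = Det A ⟨v, w⟩`, where `Det A` is the
factor by which `A` scales oriented volumes. -/
theorem inner_cof_apply (oV : Orientation ℝ V (Fin d)) (oW : Orientation ℝ W (Fin d)) (hd : d ≠ 0)
    {A : V →ₗ[ℝ] W} {c : ℝ} (h : oW.volumeForm.compLinearMap A = c • oV.volumeForm) (v w : V) :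
    inner ℝ (cof oV oW A v) (A w) = c * inner ℝ v w := by
  have h1 : (exteriorPower.oneEquiv (R := ℝ) (M := V)).symm v =
      exteriorPower.ιMulti ℝ 1 (fun _ ↦ v) := by
    rw [LinearEquiv.symm_apply_eq, exteriorPower.oneEquiv_ιMulti]
  have hι : ExteriorAlgebra.ιMulti ℝ 1 (fun _ : Fin 1 ↦ v) = ExteriorAlgebra.ι ℝ v := by
    simp [ExteriorAlgebra.ιMulti_apply]
  simp only [cof, LinearMap.smul_apply, LinearMap.comp_apply, LinearEquiv.coe_coe,
    inner_smul_left, conj_trivial, h1]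
  -- Pairing with A w turns the outer Hodge dual into Vol(⋀A(⋆v) ∧ A w) = Vol(⋀A(⋆v ∧ w)), and A
  -- scales volumes by c.
  rw [inner_oneEquiv_hodgeStar, coe_exteriorPower_map, ← ExteriorAlgebra.map_apply_ι, ← map_mul,
    volFunctional_comp_map oV oW h]
  -- That is, ⋆v ∧ w = (-1)^(d-1) ⟨v, w⟩ Vol.
  have h2 : volFunctional oV ((hodgeStar oV 1 (d - 1) (exteriorPower.ιMulti ℝ 1 fun _ ↦ v) :
      ExteriorAlgebra ℝ V) * ExteriorAlgebra.ι ℝ w) = (-1) ^ (d - 1) * inner ℝ v w := by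
    rw [← sum_volFunctional_mul_volFunctional oV hd Fact.out (stdOrthonormalBasis ℝ V) v w,
      Finset.mul_sum]
    simp only [hodgeStar, LinearMap.sum_apply, LinearMap.smulRight_apply,
      AddSubmonoidClass.coe_finsetSum,
      Finset.sum_mul, map_sum]
    refine Finset.sum_congr rfl fun J _ ↦ ?_
    simp [hι, ι_mul_ιMulti_comm]
    ring
  rw [h2]
  have : ((-1 : ℝ) ^ (d - 1)) * (-1) ^ (d - 1) = 1 := by rw [← mul_pow]; simp
  linear_combination c * inner ℝ v w * this

end Cofactor

/-! ### Derivatives of determinants and the Piola identity in a vector space -/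

section Calculus

variable {X : Type*} [NormedAddCommGroup X] [NormedSpace ℝ X] {S : Set X} {x₀ : X}

/-- In the Leibniz expansion only the identity permutation contributes: after one factor is
differentiated, the product of the others vanishes unless σ fixes all remaining indices, and then σ
= 1. -/
lemma hasFDerivWithinAt_matrix_det_of_eq_one {n : Type*} [Fintype n] [DecidableEq n]
    {M : X → Matrix n n ℝ} {M' : n → n → X →L[ℝ] ℝ}
    (h : ∀ i j, HasFDerivWithinAt (fun x ↦ M x i j) (M' i j) S x₀) (h1 : M x₀ = 1) :
    HasFDerivWithinAt (fun x ↦ (M x).det) (∑ i, M' i i) S x₀ := by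
  have hprod (σ : Equiv.Perm n) : HasFDerivWithinAt (fun x ↦ ∏ i, M x (σ i) i)
      (∑ i, (∏ j ∈ Finset.univ.erase i, M x₀ (σ j) j) • M' (σ i) i) S x₀ :=
    HasFDerivWithinAt.finsetProd fun i _ ↦ h (σ i) i
  have hsum := HasFDerivWithinAt.fun_sum (u := Finset.univ) fun σ _ ↦
    (hprod σ).const_smul (Equiv.Perm.sign σ : ℤ)
  have hfun : (fun x ↦ (M x).det) = fun x ↦ ∑ σ : Equiv.Perm n,
      (Equiv.Perm.sign σ : ℤ) • ∏ i, M x (σ i) i := by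
    funext x; rw [Matrix.det_apply]; rfl
  rw [hfun]
  refine hsum.congr_fderiv ?_
  symm
  rw [Finset.sum_eq_single (1 : Equiv.Perm n)]
  · simp only [Equiv.Perm.sign_one, Units.val_one, one_smul, Equiv.Perm.one_apply]
    refine Finset.sum_congr rfl fun i _ ↦ ?_
    simp [h1]
  · intro σ _ hσ
    have : ∀ i, ∏ j ∈ Finset.univ.erase i, M x₀ (σ j) j = 0 := by
      intro i
      by_contra hne
      refine hσ (Equiv.ext fun j ↦ ?_)
      have hfix : ∀ j, j ≠ i → σ j = j := by
        intro j hj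
        by_contra hj'
        exact hne (Finset.prod_eq_zero (Finset.mem_erase.2 ⟨hj, Finset.mem_univ j⟩)
          (by simp [h1, hj']))
      by_cases hj : j = i
      · subst hj
        by_contra hj'
        exact hj' (σ.injective (hfix _ hj'))
      · simpa using hfix j hj
    simp [this]
  · simp

variable {E : Type*} [NormedAddCommGroup E] [NormedSpace ℝ E] [FiniteDimensional ℝ E]

/-- Jacobi's formula at an invertible point, reduced to the identity matrix by det A(x) = det A(x₀)
· det(B A(x)) with B inverse to A(x₀). -/
lemma hasFDerivWithinAt_det {A : X → E →L[ℝ] E} {A' : X →L[ℝ] E →L[ℝ] E}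
    (hA : HasFDerivWithinAt A A' S x₀) {B : E →L[ℝ] E} (hB : B ∘L A x₀ = .id ℝ E) :
    ∃ D : X →L[ℝ] ℝ, HasFDerivWithinAt (fun x ↦ (A x).det) D S x₀ ∧
      ∀ w, D w = (A x₀).det * LinearMap.trace ℝ E (B ∘L A' w : E →L[ℝ] E) := by
  let b := Module.finBasis ℝ E
  let c (i : Fin (finrank ℝ E)) : E →L[ℝ] ℝ := LinearMap.toContinuousLinearMap (b.coord i)
  have hentry (i j : Fin (finrank ℝ E)) : HasFDerivWithinAt
      (fun x ↦ LinearMap.toMatrix b b (B ∘L A x : E →L[ℝ] E) i j)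
      ((c i ∘L B) ∘L (ContinuousLinearMap.apply ℝ E (b j)) ∘L A') S x₀ := by
    have := ((c i ∘L B) ∘L (ContinuousLinearMap.apply ℝ E (b j))).hasFDerivAt.comp_hasFDerivWithinAt
      x₀ hA
    refine this.congr_of_eventuallyEq (Filter.Eventually.of_forall fun x ↦ ?_) ?_ <;>
    simp [LinearMap.toMatrix_apply, c]
  have h1 : LinearMap.toMatrix b b (B ∘L A x₀ : E →L[ℝ] E) = 1 := by
    rw [hB]; exact LinearMap.toMatrix_id b
  have hdet := (hasFDerivWithinAt_matrix_det_of_eq_one hentry h1).const_mul (A x₀).det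
  have hBdet : B.det * (A x₀).det = 1 := by
    have := congrArg ContinuousLinearMap.det hB
    simpa [ContinuousLinearMap.det, LinearMap.det_comp] using this
  have hmul (x : X) : (A x).det =
      (A x₀).det * (LinearMap.toMatrix b b (B ∘L A x : E →L[ℝ] E)).det := by
    rw [LinearMap.det_toMatrix]
    change _ = _ * LinearMap.det (B.toLinearMap ∘ₗ (A x).toLinearMap)
    rw [LinearMap.det_comp]
    change _ = (A x₀).det * (B.det * (A x).det)
    linear_combination -(A x).det * hBdet
  refine ⟨_, hdet.congr_of_eventuallyEq (Filter.Eventually.of_forall hmul) (hmul x₀), fun w ↦ ?_⟩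
  · rw [LinearMap.trace_eq_matrix_trace ℝ b]
    simp [Matrix.trace, LinearMap.toMatrix_apply, c]

/-- The Piola identity in a vector space: the divergence of `det A • A⁻¹ v`, where `A` is the
derivative of a `C^2` map, is `det A * tr (A⁻¹ dv)`. -/
theorem hasFDerivWithinAt_det_smul_inverse {F v : E → E} {v' : E →L[ℝ] E} {S : Set E} {x₀ : E}
    (hS : UniqueDiffOn ℝ S) (hx₀ : x₀ ∈ S) (hx₀' : x₀ ∈ closure (interior S))
    (hF : ContDiffWithinAt ℝ 2 F S x₀) (hinv : (fderivWithin ℝ F S x₀).IsInvertible)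
    (hv : HasFDerivWithinAt v v' S x₀) :
    ∃ V' : E →L[ℝ] E, HasFDerivWithinAt (fun x ↦ (fderivWithin ℝ F S x).det •
        (fderivWithin ℝ F S x).inverse (v x)) V' S x₀ ∧
      LinearMap.trace ℝ E V' = (fderivWithin ℝ F S x₀).det *
        LinearMap.trace ℝ E ((fderivWithin ℝ F S x₀).inverse ∘L v' : E →L[ℝ] E) := by
  set A := fderivWithin ℝ F S with hAdef
  have hA : DifferentiableWithinAt ℝ A S x₀ :=
    (hF.fderivWithin_right hS (m := 1) (by norm_num) hx₀).differentiableWithinAt (by norm_num)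
  -- Symmetry of the second derivative extends to boundary points of S because x₀ is a limit of
  -- interior points.
  have hsymm : IsSymmSndFDerivWithinAt ℝ F S x₀ := by
    apply hF.isSymmSndFDerivWithinAt _ hS hx₀' hx₀
    simp
  set A' := fderivWithin ℝ A S x₀ with hA'def
  have hA' : HasFDerivWithinAt A A' S x₀ := hA.hasFDerivWithinAt
  obtain ⟨e, he⟩ := hinv
  set B := (A x₀).inverse with hBdef
  have hB : B = (e.symm : E →L[ℝ] E) := by rw [hBdef, ← he, ContinuousLinearMap.inverse_equiv]
  have hBA : B ∘L A x₀ = .id ℝ E := by rw [hB, ← he]; ext; simp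
  have hAB : A x₀ ∘L B = .id ℝ E := by rw [hB, ← he]; ext; simp
  obtain ⟨D, hD, hDw⟩ := hasFDerivWithinAt_det hA' hBA
  -- The derivative of inversion at A(x₀) is T ↦ -B T B.
  have hI : HasFDerivAt (ContinuousLinearMap.inverse : (E →L[ℝ] E) → E →L[ℝ] E)
      (-((ContinuousLinearMap.compL ℝ E E E B).comp
        ((ContinuousLinearMap.compL ℝ E E E).flip B))) (A x₀) := by
    rw [← ContinuousLinearMap.ringInverse_eq_inverse]
    let u : (E →L[ℝ] E)ˣ := ⟨A x₀, B, hAB, hBA⟩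
    refine (hasFDerivAt_ringInverse (𝕜 := ℝ) u).congr_fderiv ?_
    ext T w
    rfl
  have hIA := hI.comp_hasFDerivWithinAt x₀ hA'
  have hV := hD.smul (hIA.clm_apply hv)
  -- The product rule yields the term -B(A' w (B v)). By symmetry it equals -B(A'(B v) w), which as
  -- a map in w has trace -tr(B A'(B v)). Jacobi's formula gives the rank-one term the trace D(B v)
  -- = det A · tr(B A'(B v)), so the two cancel.
  refine ⟨(A x₀).det • (B ∘L v' - B ∘L A' (B (v x₀))) + D.smulRight (B (v x₀)),
    hV.congr_fderiv ?_, ?_⟩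
  · ext1 w
    have : A' w (B (v x₀)) = A' (B (v x₀)) w := hsymm.eq _ _
    simp [← this, ← hBdef]
    module
  · have h1 : LinearMap.trace ℝ E (D.smulRight (B (v x₀)) : E →L[ℝ] E) = D (B (v x₀)) :=
      LinearMap.trace_smulRight D.toLinearMap _
    simp only [ContinuousLinearMap.toLinearMap_add, ContinuousLinearMap.toLinearMap_smul,
      ContinuousLinearMap.toLinearMap_sub, map_add, map_smul, map_sub, h1, hDw, smul_eq_mul]
    ring

end Calculus

/-! ### The metric and the derivative of a map in coordinates -/

section Coordinates

variable {d : ℕ} {H : Type*} [TopologicalSpace H]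
  {I : ModelWithCorners ℝ (EuclideanSpace ℝ (Fin d)) H}
  {M : Type*} [TopologicalSpace M] [ChartedSpace H M] [IsManifold I ∞ M]

variable (I) in
/-- The coordinates of a tangent vector at `x` with respect to the preferred chart at `q`. -/
def coords (q x : M) : TangentSpace I x →L[ℝ] EuclideanSpace ℝ (Fin d) :=
  (trivializationAt (EuclideanSpace ℝ (Fin d)) (TangentSpace I) q).continuousLinearMapAt ℝ x

variable (I) in
/-- The coordinate vector fields at `x`, as a linear map in the coefficients. -/
def coordFieldL (q x : M) : EuclideanSpace ℝ (Fin d) →L[ℝ] TangentSpace I x :=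
  (trivializationAt (EuclideanSpace ℝ (Fin d)) (TangentSpace I) q).symmL ℝ x

lemma coordFieldL_apply (q x : M) (u : EuclideanSpace ℝ (Fin d)) :
    coordFieldL I q x u = coordField I q u x := rfl

lemma coords_apply {q x : M} (hx : x ∈ (chartAt H q).source) (v : TangentSpace I x) :
    coords I q x v = (trivializationAt (EuclideanSpace ℝ (Fin d)) (TangentSpace I) q ⟨x, v⟩).2 := by
  rw [coords, Trivialization.continuousLinearMapAt_apply, Trivialization.linearMapAt_apply, if_pos]
  simpa using hx

lemma coordFieldL_coords {q x : M} (hx : x ∈ (chartAt H q).source) (v : TangentSpace I x) :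
    coordFieldL I q x (coords I q x v) = v :=
  (trivializationAt (EuclideanSpace ℝ (Fin d)) (TangentSpace I) q).symmL_continuousLinearMapAt
    (by simpa using hx) v

lemma coords_coordFieldL {q x : M} (hx : x ∈ (chartAt H q).source) (u : EuclideanSpace ℝ (Fin d)) :
    coords I q x (coordFieldL I q x u) = u :=
  (trivializationAt (EuclideanSpace ℝ (Fin d)) (TangentSpace I) q).continuousLinearMapAt_symmL
    (by simpa using hx) u

/-- `TangentSpace I q` is the model space by definition, and the preferred chart at q induces
exactly this identification, since the coordinate change from that chart to itself is the identity.
-/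
lemma coords_self (q : M) (v : TangentSpace I q) : coords I q q v = v := by
  rw [coords, TangentBundle.continuousLinearMapAt_trivializationAt_eq_core (by simp)]
  exact (tangentBundleCore I M).coordChange_self (achart H q) q (mem_chart_source H q) v

lemma coordFieldL_self (q : M) (u : EuclideanSpace ℝ (Fin d)) : coordFieldL I q q u = u := by
  have h := coords_self (I := I) q (coordFieldL I q q u)
  rw [coords_coordFieldL (mem_chart_source H q)] at h
  exact h.symm

/-- The coordinates of the derivative of a map are the derivative of the map in coordinates. -/
lemma hasFDerivWithinAt_writtenInCharts {M' : Type*} [TopologicalSpace M'] [ChartedSpace H M']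
    [IsManifold I ∞ M'] {f : M → M'} {x a : M} {b : M'} (hf : MDifferentiableAt I I f x)
    (hx : x ∈ (chartAt H a).source) (hfx : f x ∈ (chartAt H b).source) :
    HasFDerivWithinAt (extChartAt I b ∘ f ∘ (extChartAt I a).symm)
      (coords I b (f x) ∘L mfderiv I I f x ∘L coordFieldL I a x) (Set.range I)
      (extChartAt I a x) := by
  have hx' : x ∈ (extChartAt I a).source := by simpa using hx
  have h1 : HasMFDerivWithinAt 𝓘(ℝ, EuclideanSpace ℝ (Fin d)) I (extChartAt I a).symm (Set.range I)
      (extChartAt I a x) (coordFieldL I a x) := by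
    rw [coordFieldL, TangentBundle.symmL_trivializationAt hx]
    have := (mdifferentiableWithinAt_extChartAt_symm (I := I) (x := a)
      ((extChartAt I a).map_source hx')).hasMFDerivWithinAt
    exact this
  have hinv : (extChartAt I a).symm (extChartAt I a x) = x := (extChartAt I a).left_inv hx'
  have h2 : HasMFDerivAt I I f ((extChartAt I a).symm (extChartAt I a x)) (mfderiv I I f x) := by
    rw [hinv]; exact hf.hasMFDerivAt
  have h3 : HasMFDerivAt I 𝓘(ℝ, EuclideanSpace ℝ (Fin d)) (extChartAt I b)
      (f ((extChartAt I a).symm (extChartAt I a x))) (coords I b (f x)) := by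
    rw [hinv, coords, TangentBundle.continuousLinearMapAt_trivializationAt hfx]
    exact (mdifferentiableAt_extChartAt hfx).hasMFDerivAt
  have h4 := h3.comp_hasMFDerivWithinAt (f := f ∘ (extChartAt I a).symm) (extChartAt I a x)
    (h2.comp_hasMFDerivWithinAt _ h1)
  exact hasMFDerivWithinAt_iff_hasFDerivWithinAt.1 h4

lemma contMDiffAt_coordField {q x : M} (hx : x ∈ (chartAt H q).source)
    (u : EuclideanSpace ℝ (Fin d)) :
    ContMDiffAt I I.tangent ∞ (fun x ↦ (⟨x, coordField I q u x⟩ : TangentBundle I M)) x := by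
  have hb : x ∈ (trivializationAt (EuclideanSpace ℝ (Fin d)) (TangentSpace I) q).baseSet := by
    simpa using hx
  rw [(trivializationAt (EuclideanSpace ℝ (Fin d)) (TangentSpace I) q).contMDiffAt_section_iff hb]
  refine (contMDiffAt_const (c := u)).congr_of_eventuallyEq ?_
  filter_upwards [(chartAt H q).open_source.mem_nhds hx] with y hy
  have := coords_coordFieldL (I := I) hy u
  rwa [coords_apply hy] at this

variable [RiemannianBundle (fun x : M ↦ TangentSpace I x)]

variable (I) in
/-- The metric in the preferred chart at `q`, as a function on the image of that chart. -/
def metricCoord (q : M) (y : EuclideanSpace ℝ (Fin d)) :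
    EuclideanSpace ℝ (Fin d) →L[ℝ] EuclideanSpace ℝ (Fin d) →L[ℝ] ℝ :=
  (innerSL ℝ (E := TangentSpace I ((extChartAt I q).symm y))).bilinearComp
    (coordFieldL I q ((extChartAt I q).symm y)) (coordFieldL I q ((extChartAt I q).symm y))

lemma metricCoord_apply (q : M) (y u v : EuclideanSpace ℝ (Fin d)) :
    metricCoord I q y u v = inner ℝ (coordField I q u ((extChartAt I q).symm y))
      (coordField I q v ((extChartAt I q).symm y)) := rfl

lemma inner_eq_metricCoord {q x : M} (hx : x ∈ (chartAt H q).source) (v w : TangentSpace I x) :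
    inner ℝ v w = metricCoord I q (extChartAt I q x) (coords I q x v) (coords I q x w) := by
  have hx' : (extChartAt I q).symm (extChartAt I q x) = x :=
    (extChartAt I q).left_inv (by simpa using hx)
  rw [metricCoord_apply]
  rw [hx', ← coordFieldL_apply, ← coordFieldL_apply, coordFieldL_coords hx, coordFieldL_coords hx]

variable [IsContMDiffRiemannianBundle I ∞ (EuclideanSpace ℝ (Fin d))
      (fun x : M ↦ TangentSpace I x)]

lemma contDiffOn_metricCoord (q : M) :
    ContDiffOn ℝ ∞ (metricCoord I q) (extChartAt I q).target := by
  rw [contDiffOn_clm_apply]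
  intro u
  rw [contDiffOn_clm_apply]
  intro v y hy
  have hy' : (extChartAt I q).symm y ∈ (chartAt H q).source := by
    simpa using (extChartAt I q).map_target hy
  have h1 : ContMDiffAt I 𝓘(ℝ, ℝ) ∞
      (fun x : M ↦ inner ℝ (coordField I q u x) (coordField I q v x)) ((extChartAt I q).symm y) :=
    ContMDiffAt.inner_bundle (F := EuclideanSpace ℝ (Fin d)) (E := fun x : M ↦ TangentSpace I x)
      (contMDiffAt_coordField hy' u) (contMDiffAt_coordField hy' v)
  have h2 := h1.comp_contMDiffWithinAt y (contMDiffOn_extChartAt_symm (I := I) (n := ∞) q y hy)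
  exact contMDiffWithinAt_iff_contDiffWithinAt.1 h2

end Coordinates

/-! ### The Riemannian density in coordinates -/

section Gram

variable {d : ℕ} {V : Type*} [NormedAddCommGroup V] [InnerProductSpace ℝ V]

/-- With P the matrix of the components of v in an orthonormal basis, the Gram matrix is PᵀP. So
√(det g) is the absolute volume of the coordinate frame. -/
lemma det_gram_eq_sq (e : OrthonormalBasis (Fin d) ℝ V) (v : Fin d → V) :
    (Matrix.of fun i j ↦ inner ℝ (v i) (v j)).det = e.toBasis.det v ^ 2 := by
  have : (Matrix.of fun i j ↦ inner ℝ (v i) (v j)) =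
      (e.toBasis.toMatrix v).transpose * e.toBasis.toMatrix v := by
    ext i j
    simp only [Matrix.of_apply, Matrix.mul_apply, Matrix.transpose_apply, Basis.toMatrix_apply,
      OrthonormalBasis.coe_toBasis_repr_apply, OrthonormalBasis.repr_apply_apply]
    rw [← e.sum_inner_mul_inner (v i) (v j)]
    simp only [real_inner_comm]
  rw [this, Matrix.det_mul, Matrix.det_transpose, Basis.det_apply, sq]

/-- Pulled back along L, η becomes a top-degree form on ℝᵈ, hence a multiple of the determinant.
Since L need not be invertible, the lemma also applies off the domain of a chart. -/
lemma alternatingMap_apply_comp {V : Type*} [AddCommGroup V] [Module ℝ V]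
    (η : V [⋀^Fin d]→ₗ[ℝ] ℝ) (L : EuclideanSpace ℝ (Fin d) →ₗ[ℝ] V)
    (J : EuclideanSpace ℝ (Fin d) →ₗ[ℝ] EuclideanSpace ℝ (Fin d)) :
    η (fun i ↦ L (J (EuclideanSpace.single i 1))) =
      LinearMap.det J * η (fun i ↦ L (EuclideanSpace.single i 1)) := by
  let b := (EuclideanSpace.basisFun (Fin d) ℝ).toBasis
  have hb (i : Fin d) : b i = EuclideanSpace.single i 1 := by simp [b]
  have h := (η.compLinearMap L).eq_smul_basis_det b
  have h1 := congrArg (fun φ ↦ φ (J ∘ b)) h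
  simp only [AlternatingMap.smul_apply, Basis.det_comp, Basis.det_self, mul_one,
    AlternatingMap.compLinearMap_apply, smul_eq_mul, Function.comp_apply, hb] at h1
  rw [h1, mul_comm]

variable [Fact (finrank ℝ V = d)]

lemma volumeForm_pos_iff (hd : d ≠ 0) (o : Orientation ℝ V (Fin d)) (b : Basis (Fin d) ℝ V) :
    0 < o.volumeForm b ↔ b.orientation = o := by
  have : Nonempty (Fin d) := ⟨⟨0, Nat.pos_of_ne_zero hd⟩⟩
  have : FiniteDimensional ℝ V := b.finiteDimensional_of_finite
  let e := o.finOrthonormalBasis (Nat.pos_of_ne_zero hd) Fact.out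
  have he : e.toBasis.orientation = o := o.finOrthonormalBasis_orientation _ _
  rw [o.volumeForm_robust e he, ← Basis.orientation_eq_iff_det_pos, he]
  exact eq_comm

end Gram

section Density

set_option linter.unusedSectionVars false

variable {d : ℕ} {H : Type*} [TopologicalSpace H]
  {I : ModelWithCorners ℝ (EuclideanSpace ℝ (Fin d)) H}
  {M : Type*} [TopologicalSpace M] [ChartedSpace H M] [IsManifold I ∞ M]

variable (I) in
/-- The frame of coordinate vector fields of the preferred chart at `q`. -/
def coordFrame (q x : M) (i : Fin d) : TangentSpace I x :=
  coordFieldL I q x (EuclideanSpace.single i 1)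

variable (I) in
/-- The coordinates in the chart at `q`, as a linear equivalence. -/
def coordsEquiv (q x : M) (hx : x ∈ (chartAt H q).source) :
    EuclideanSpace ℝ (Fin d) ≃L[ℝ] TangentSpace I x :=
  ContinuousLinearEquiv.equivOfInverse (coordFieldL I q x) (coords I q x)
    (coords_coordFieldL hx) (coordFieldL_coords hx)

variable (I) in
/-- The coordinate frame as a basis. -/
def coordBasis (q x : M) (hx : x ∈ (chartAt H q).source) :
    Basis (Fin d) ℝ (TangentSpace I x) :=
  (EuclideanSpace.basisFun (Fin d) ℝ).toBasis.map (coordsEquiv I q x hx).toLinearEquiv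

lemma coe_coordBasis (q x : M) (hx : x ∈ (chartAt H q).source) :
    ⇑(coordBasis I q x hx) = coordFrame I q x := by
  funext i
  simp [coordBasis, coordFrame, coordsEquiv]

variable [RiemannianBundle (fun x : M ↦ TangentSpace I x)]

/-- The orthonormal basis of a tangent space, indexed by `Fin d`. -/
def tangentONB (x : M) : OrthonormalBasis (Fin d) ℝ (TangentSpace I x) :=
  (stdOrthonormalBasis ℝ (TangentSpace I x)).reindex
    (finCongr (Fact.out : finrank ℝ (TangentSpace I x) = d))

variable (I) in
/-- The density `√(det g)` of the Riemannian volume in the preferred chart at `q`. -/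
def density (q : M) (y : EuclideanSpace ℝ (Fin d)) : ℝ :=
  Real.sqrt (gramMatrix I q y).det

lemma det_gramMatrix_eq_sq (q : M) (y : EuclideanSpace ℝ (Fin d))
    (e : OrthonormalBasis (Fin d) ℝ (TangentSpace I ((extChartAt I q).symm y))) :
    (gramMatrix I q y).det = e.toBasis.det (coordFrame I q ((extChartAt I q).symm y)) ^ 2 :=
  det_gram_eq_sq e _

lemma density_eq_abs {q x : M} (hx : x ∈ (chartAt H q).source)
    (e : OrthonormalBasis (Fin d) ℝ (TangentSpace I x)) :
    density I q (extChartAt I q x) = |e.toBasis.det (coordFrame I q x)| := by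
  have hx' : (extChartAt I q).symm (extChartAt I q x) = x :=
    (extChartAt I q).left_inv (by simpa using hx)
  rw [density, ← Real.sqrt_sq_eq_abs, ← det_gram_eq_sq e]
  congr 2
  unfold gramMatrix
  rw [hx']
  rfl

lemma density_pos {q x : M} (hx : x ∈ (chartAt H q).source) :
    0 < density I q (extChartAt I q x) := by
  rw [density_eq_abs hx (tangentONB x), abs_pos, ← coe_coordBasis q x hx]
  exact ((tangentONB x).toBasis.isUnit_det _).ne_zero

lemma density_pos' {q : M} {y : EuclideanSpace ℝ (Fin d)} (hy : y ∈ (extChartAt I q).target) :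
    0 < density I q y := by
  have := density_pos (I := I) (q := q) (x := (extChartAt I q).symm y)
    (by simpa using (extChartAt I q).map_target hy)
  rwa [(extChartAt I q).right_inv hy] at this

/-- The transformation of the density under a change of charts. -/
lemma density_eq_abs_det_mul {q r x : M} (hq : x ∈ (chartAt H q).source)
    (hr : x ∈ (chartAt H r).source) :
    density I q (extChartAt I q x) =
      |(coords I r x ∘L coordFieldL I q x).det| * density I r (extChartAt I r x) := by
  rw [density_eq_abs hq (tangentONB x), density_eq_abs hr (tangentONB x), ← abs_mul]
  have := alternatingMap_apply_comp (tangentONB x).toBasis.det (coordFieldL I r x).toLinearMap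
    (coords I r x ∘L coordFieldL I q x).toLinearMap
  congr 1
  rw [ContinuousLinearMap.det]
  simpa [coordFieldL_coords hr] using! this

/-- The oriented volume of the coordinate frame is, up to a locally constant sign, the density. -/
lemma exists_sign_volumeForm_coordFrame (hd : d ≠ 0) (o : ManifoldOrientation I M) (q : M) :
    ∃ s : ℝ, s * s = 1 ∧ ∀ᶠ x in 𝓝 q,
      (o.at' x).volumeForm (coordFrame I q x) = s * density I q (extChartAt I q x) := by
  -- Positivity of the frame's volume is restated as the transported orientation being the standard
  -- one, because `locallyConstant` speaks of transported orientations.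
  have hpos (x : M) (hx : x ∈ (chartAt H q).source)
      (hx' : x ∈ (trivializationAt (EuclideanSpace ℝ (Fin d)) (TangentSpace I) q).baseSet) :
      0 < (o.at' x).volumeForm (coordFrame I q x) ↔ Orientation.map (Fin d)
        ((trivializationAt (EuclideanSpace ℝ (Fin d)) (TangentSpace I) q).linearEquivAt ℝ x hx')
          (o.at' x) = (EuclideanSpace.basisFun (Fin d) ℝ).toBasis.orientation := by
    rw [← coe_coordBasis q x hx, volumeForm_pos_iff hd, coordBasis, Basis.orientation_map]
    have : (coordsEquiv I q x hx).toLinearEquiv =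
        ((trivializationAt (EuclideanSpace ℝ (Fin d))
          (TangentSpace I) q).linearEquivAt ℝ x hx').symm := by
      ext u
      rw [LinearEquiv.eq_symm_apply]
      have h := coords_coordFieldL (I := I) hx u
      rw [coords_apply hx] at h
      exact h
    rw [this, ← Orientation.map_symm, Equiv.symm_apply_eq]
    exact eq_comm
  have habs (x : M) (hx : x ∈ (chartAt H q).source) :
      |(o.at' x).volumeForm (coordFrame I q x)| = density I q (extChartAt I q x) := by
    rw [density_eq_abs hx (tangentONB x), Orientation.volumeForm_robust' _ (tangentONB x)]
  have hq := mem_chart_source H q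
  have hsrc := (chartAt H q).open_source.mem_nhds hq
  have hbase {x : M} (hx : x ∈ (chartAt H q).source) :
      x ∈ (trivializationAt (EuclideanSpace ℝ (Fin d)) (TangentSpace I) q).baseSet := by
    simpa using hx
  by_cases h : 0 < (o.at' q).volumeForm (coordFrame I q q)
  · refine ⟨1, by norm_num, ?_⟩
    filter_upwards [hsrc, o.locallyConstant q] with x hx hloc
    have : 0 < (o.at' x).volumeForm (coordFrame I q x) := by
      rw [hpos x hx (hbase hx), hloc (hbase hx), ← hpos q hq]
      exact h
    rw [one_mul, ← habs x hx, abs_of_pos this]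
  · refine ⟨-1, by norm_num, ?_⟩
    filter_upwards [hsrc, o.locallyConstant q] with x hx hloc
    have : ¬ 0 < (o.at' x).volumeForm (coordFrame I q x) := by
      rw [hpos x hx (hbase hx), hloc (hbase hx), ← hpos q hq]
      exact h
    rw [← habs x hx, abs_of_nonpos (not_lt.1 this)]
    ring

variable [IsContMDiffRiemannianBundle I ∞ (EuclideanSpace ℝ (Fin d))
      (fun x : M ↦ TangentSpace I x)]

lemma contDiffOn_density (q : M) : ContDiffOn ℝ ∞ (density I q) (extChartAt I q).target := by
  have hentry (i j : Fin d) : ContDiffOn ℝ ∞ (fun y ↦ gramMatrix I q y i j)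
      (extChartAt I q).target := by
    have h := contDiffOn_metricCoord (I := I) q
    exact (h.clm_apply contDiffOn_const).clm_apply contDiffOn_const
  refine ContDiffOn.sqrt ?_ fun y hy ↦ ?_
  · simp_rw [Matrix.det_apply]
    exact ContDiffOn.sum fun σ _ ↦ (contDiffOn_prod fun i _ ↦ hentry _ _).const_smul _
  · exact (Real.sqrt_pos.1 (density_pos' hy)).ne'

lemma contDiffWithinAt_density {q : M} {y : EuclideanSpace ℝ (Fin d)}
    (hy : y ∈ (extChartAt I q).target) : ContDiffWithinAt ℝ ∞ (density I q) (Set.range I) y :=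
  (contDiffOn_density q y hy).mono_of_mem_nhdsWithin (extChartAt_target_mem_nhdsWithin_of_mem hy)

lemma differentiableWithinAt_metricCoord {q : M} {y : EuclideanSpace ℝ (Fin d)}
    (hy : y ∈ (extChartAt I q).target) :
    DifferentiableWithinAt ℝ (metricCoord I q) (Set.range I) y :=
  ((contDiffOn_metricCoord q y hy).mono_of_mem_nhdsWithin
    (extChartAt_target_mem_nhdsWithin_of_mem hy)).differentiableWithinAt (by simp)

/-- The logarithmic derivative of the density. -/
lemma hasFDerivWithinAt_density_self (q : M) :
    HasFDerivWithinAt (density I q) ((density I q (extChartAt I q q) / 2) •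
        ∑ i, (((fderivWithin ℝ (metricCoord I q) (Set.range I) (extChartAt I q q)).flip
          (coords I q q (tangentONB q i))).flip (coords I q q (tangentONB q i))))
      (Set.range I) (extChartAt I q q) := by
  set y₀ := extChartAt I q q
  -- The u i are the coordinates of an orthonormal basis at q, held constant in y. In this frame the
  -- metric matrix Q is the identity at y₀, so Jacobi's formula applies there. The constant change
  -- of frame K only contributes the factor |det K|.
  let u (i : Fin d) : EuclideanSpace ℝ (Fin d) := coords I q q (tangentONB q i)
  let K : EuclideanSpace ℝ (Fin d) →ₗ[ℝ] EuclideanSpace ℝ (Fin d) :=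
    (EuclideanSpace.basisFun (Fin d) ℝ).toBasis.constr ℝ u
  have hK (i : Fin d) : K (EuclideanSpace.single i 1) = u i := by
    have := (EuclideanSpace.basisFun (Fin d) ℝ).toBasis.constr_basis ℝ u i
    rwa [OrthonormalBasis.coe_toBasis, EuclideanSpace.basisFun_apply] at this
  let Q (y : EuclideanSpace ℝ (Fin d)) : Matrix (Fin d) (Fin d) ℝ :=
    Matrix.of fun i j ↦ metricCoord I q y (u i) (u j)
  have hQ (y : EuclideanSpace ℝ (Fin d)) :
      (Q y).det = LinearMap.det K ^ 2 * (gramMatrix I q y).det := by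
    have e := tangentONB (I := I) ((extChartAt I q).symm y)
    have h1 : (Q y).det = e.toBasis.det
        (fun i ↦ coordFieldL I q ((extChartAt I q).symm y) (u i)) ^ 2 := det_gram_eq_sq e _
    have h2 := alternatingMap_apply_comp e.toBasis.det
      (coordFieldL I q ((extChartAt I q).symm y)).toLinearMap K
    simp only [hK] at h2
    rw [h1, det_gramMatrix_eq_sq q y e, ← mul_pow]
    exact congrArg (· ^ 2) h2
  have hQ1 : Q y₀ = 1 := by
    ext i j
    have h := inner_eq_metricCoord (I := I) (mem_chart_source H q) (tangentONB q i) (tangentONB q j)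
    rw [OrthonormalBasis.inner_eq_ite] at h
    rw [Matrix.one_apply, h]
    rfl
  have hmet := (differentiableWithinAt_metricCoord (I := I)
    (mem_extChartAt_target q)).hasFDerivWithinAt
  have hdet := hasFDerivWithinAt_matrix_det_of_eq_one (M := Q) (fun i j ↦
    (hmet.clm_apply (hasFDerivWithinAt_const (u i) _ _)).clm_apply
      (hasFDerivWithinAt_const (u j) _ _)) hQ1
  have hsqrt := (hdet.sqrt (by change (Q y₀).det ≠ 0; simp [hQ1])).const_mul |LinearMap.det K|⁻¹
  have hK0 : LinearMap.det K ≠ 0 := by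
    intro h0
    have := hQ y₀
    rw [h0, hQ1] at this
    simp at this
  have hden (y : EuclideanSpace ℝ (Fin d)) :
      density I q y = |LinearMap.det K|⁻¹ * Real.sqrt (Q y).det := by
    rw [hQ, Real.sqrt_mul (sq_nonneg _), Real.sqrt_sq_eq_abs, ← mul_assoc,
      inv_mul_cancel₀ (abs_ne_zero.2 hK0), one_mul, density]
  refine (hsqrt.congr_of_eventuallyEq (Filter.Eventually.of_forall hden)
    (hden y₀)).congr_fderiv ?_
  rw [hden y₀, hQ1]
  ext w
  simp [u, y₀]
  ring

end Density

/-! ### Christoffel symbols and the pullback connection -/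

section Bilinear

variable {X E : Type*} [NormedAddCommGroup X] [NormedSpace ℝ X] [NormedAddCommGroup E]
  [NormedSpace ℝ E]

lemma hasFDerivWithinAt_bilinear_comp {g : E → E →L[ℝ] E →L[ℝ] ℝ} {F u v : X → E}
    {F' u' v' : X →L[ℝ] E} {S : Set X} {T : Set E} {x : X}
    (hg : DifferentiableWithinAt ℝ g T (F x)) (hF : HasFDerivWithinAt F F' S x)
    (hST : Set.MapsTo F S T) (hu : HasFDerivWithinAt u u' S x) (hv : HasFDerivWithinAt v v' S x) :
    ∃ D : X →L[ℝ] ℝ, HasFDerivWithinAt (fun y ↦ g (F y) (u y) (v y)) D S x ∧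
      ∀ w, D w = fderivWithin ℝ g T (F x) (F' w) (u x) (v x) + g (F x) (u' w) (v x) +
        g (F x) (u x) (v' w) := by
  have h1 := HasFDerivWithinAt.comp (G := E →L[ℝ] E →L[ℝ] ℝ) x hg.hasFDerivWithinAt hF hST
  refine ⟨_, (h1.clm_apply hu).clm_apply hv, fun w ↦ ?_⟩
  simp
  ring

end Bilinear

section Connection

set_option linter.unusedSectionVars false

variable {d : ℕ} {H : Type*} [TopologicalSpace H]
  {I : ModelWithCorners ℝ (EuclideanSpace ℝ (Fin d)) H}
  {M : Type*} [TopologicalSpace M] [ChartedSpace H M] [IsManifold I ∞ M]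

instance : NormedAddCommGroup
    (EuclideanSpace ℝ (Fin d) →L[ℝ] EuclideanSpace ℝ (Fin d) →L[ℝ] ℝ) := inferInstance

instance : NormedSpace ℝ
    (EuclideanSpace ℝ (Fin d) →L[ℝ] EuclideanSpace ℝ (Fin d) →L[ℝ] ℝ) := inferInstance

lemma mfderiv_apply_eq_fderivWithin {G : Type*} [NormedAddCommGroup G] [NormedSpace ℝ G]
    {h : M → G} {p : M} (hh : MDifferentiableAt I 𝓘(ℝ, G) h p) (v : TangentSpace I p) :
    mfderiv I 𝓘(ℝ, G) h p v = fderivWithin ℝ (h ∘ (extChartAt I p).symm) (Set.range I)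
      (extChartAt I p p) (coords I p p v) := by
  rw [coords_self, hh.mfderiv]
  rfl

/-- `MDifferentiableAt` also demands continuity. This comes for free: near p the map is its
coordinate expression composed with the continuous chart. -/
lemma mdifferentiableAt_iff_coord {G : Type*} [NormedAddCommGroup G] [NormedSpace ℝ G]
    {h : M → G} {p : M} : MDifferentiableAt I 𝓘(ℝ, G) h p ↔
      DifferentiableWithinAt ℝ (h ∘ (extChartAt I p).symm) (Set.range I) (extChartAt I p p) := by
  rw [mdifferentiableAt_iff]
  refine ⟨fun h ↦ h.2, fun hd ↦ ⟨?_, hd⟩⟩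
  have h1 : ContinuousAt (extChartAt I p) p := continuousAt_extChartAt p
  have h2 : ContinuousWithinAt ((h ∘ (extChartAt I p).symm) ∘ extChartAt I p) Set.univ p :=
    hd.continuousWithinAt.comp h1.continuousWithinAt fun x _ ↦ ⟨_, rfl⟩
  rw [continuousWithinAt_univ] at h2
  refine h2.congr ?_
  filter_upwards [extChartAt_source_mem_nhds (I := I) p] with x hx
  exact congrArg h ((extChartAt I p).left_inv hx)

lemma uniqueDiffWithinAt_coord (q x : M) :
    UniqueDiffWithinAt ℝ (Set.range I) (extChartAt I q x) :=
  I.uniqueDiffOn _ ⟨_, rfl⟩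

variable [RiemannianBundle (fun x : M ↦ TangentSpace I x)]
  [IsContMDiffRiemannianBundle I ∞ (EuclideanSpace ℝ (Fin d)) (fun x : M ↦ TangentSpace I x)]

/-- In this form the linearity of `metricDeriv` in each of its three arguments is visible. -/
lemma metricDeriv_eq (q : M) (w u v : TangentSpace I q) :
    metricDeriv I q w u v = fderivWithin ℝ (metricCoord I q) (Set.range I) (extChartAt I q q)
      (coords I q q w) (coords I q q u) (coords I q q v) := by
  obtain ⟨D, hD, hDw⟩ := hasFDerivWithinAt_bilinear_comp (T := Set.range I) (F := id)
    (differentiableWithinAt_metricCoord (I := I) (mem_extChartAt_target q))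
    (hasFDerivWithinAt_id (𝕜 := ℝ) (extChartAt I q q) (Set.range I)) (Set.mapsTo_id _)
    (hasFDerivWithinAt_const (coords I q q u) _ _) (hasFDerivWithinAt_const (coords I q q v) _ _)
  have heq : (fun x : M ↦ inner ℝ (coordField I q u x) (coordField I q v x)) ∘
      (extChartAt I q).symm = fun y ↦ metricCoord I q y (coords I q q u) (coords I q q v) := by
    funext y
    rw [coords_self, coords_self]
    rfl
  have hd : MDifferentiableAt I 𝓘(ℝ, ℝ)
      (fun x : M ↦ inner ℝ (coordField I q u x) (coordField I q v x)) q := by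
    rw [mdifferentiableAt_iff_coord, heq]
    exact hD.differentiableWithinAt
  rw [metricDeriv, mfderiv_apply_eq_fderivWithin hd, heq]
  refine (congrArg (fun φ ↦ φ (coords I q q w))
    (hD.fderivWithin (uniqueDiffWithinAt_coord q q))).trans ?_
  rw [hDw]
  simp

lemma metricDeriv_comm (q : M) (w u v : TangentSpace I q) :
    metricDeriv I q w u v = metricDeriv I q w v u := by
  have : (fun x : M ↦ inner ℝ (coordField I q u x) (coordField I q v x)) =
      fun x : M ↦ inner ℝ (coordField I q v x) (coordField I q u x) :=
    funext fun x ↦ real_inner_comm _ _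
  unfold metricDeriv
  rw [this]
  rfl

lemma inner_christoffel (q : M) (u v w : TangentSpace I q) :
    inner ℝ (christoffel I q u v) w = (1 / 2 : ℝ) *
      (metricDeriv I q u v w + metricDeriv I q v u w - metricDeriv I q w u v) := by
  have hw := (stdOrthonormalBasis ℝ (TangentSpace I q)).sum_repr' w
  conv_rhs => rw [← hw]
  rw [metricDeriv_eq, metricDeriv_eq, metricDeriv_eq]
  simp only [christoffel, sum_inner, inner_smul_left, metricDeriv_eq, map_sum, map_smul,
    _root_.sum_apply, _root_.smul_apply, smul_eq_mul, conj_trivial]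
  rw [← Finset.sum_add_distrib, ← Finset.sum_sub_distrib, Finset.mul_sum]
  refine Finset.sum_congr rfl fun i _ ↦ ?_
  ring

/-- Metric compatibility at the level of symbols: in the two Koszul expressions all terms but ∂_u⟨v,
w⟩ cancel, by the symmetry of the metric. -/
lemma inner_christoffel_add (q : M) (u v w : TangentSpace I q) :
    inner ℝ (christoffel I q u v) w + inner ℝ v (christoffel I q u w) = metricDeriv I q u v w := by
  rw [real_inner_comm (christoffel I q u w) v, inner_christoffel, inner_christoffel,
    metricDeriv_comm q u w v]
  ring

variable (I) in
/-- The Christoffel symbol as a linear map in its first argument. -/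
def christoffelL (q : M) (v : TangentSpace I q) : TangentSpace I q →ₗ[ℝ] TangentSpace I q where
  toFun u := christoffel I q u v
  map_add' u u' := by
    refine ext_inner_right ℝ fun w ↦ ?_
    simp only [inner_add_left, inner_christoffel, metricDeriv_eq, map_add,
      _root_.add_apply]
    ring
  map_smul' c u := by
    refine ext_inner_right ℝ fun w ↦ ?_
    simp only [inner_smul_left, inner_christoffel, metricDeriv_eq, map_smul,
      _root_.smul_apply, conj_trivial, smul_eq_mul, RingHom.id_apply]
    ring

/-- The trace of the Christoffel symbol is the logarithmic derivative of the density. -/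
lemma density_mul_trace_christoffelL (q : M) (v : TangentSpace I q) :
    density I q (extChartAt I q q) * LinearMap.trace ℝ _ (christoffelL I q v) =
      fderivWithin ℝ (density I q) (Set.range I) (extChartAt I q q) (coords I q q v) := by
  rw [(hasFDerivWithinAt_density_self q).fderivWithin (uniqueDiffWithinAt_coord q q),
    LinearMap.trace_eq_sum_inner _ (tangentONB q)]
  simp only [_root_.smul_apply, _root_.sum_apply,
    ContinuousLinearMap.flip_apply, smul_eq_mul, Finset.mul_sum]
  refine Finset.sum_congr rfl fun i _ ↦ ?_
  -- On the diagonal, the first and third terms of the Koszul expression cancel.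
  have h : inner ℝ (tangentONB q i) (christoffelL I q v (tangentONB q i)) =
      (1 / 2 : ℝ) * metricDeriv I q v (tangentONB q i) (tangentONB q i) := by
    rw [real_inner_comm]
    refine (inner_christoffel q _ v _).trans ?_
    rw [metricDeriv_comm q (tangentONB q i) v]
    ring
  rw [h, metricDeriv_eq]
  ring

end Connection

section Along

set_option linter.unusedSectionVars false

variable {d : ℕ} {H : Type*} [TopologicalSpace H]
  {I : ModelWithCorners ℝ (EuclideanSpace ℝ (Fin d)) H}
  {M₁ : Type*} [TopologicalSpace M₁] [ChartedSpace H M₁] [IsManifold I ∞ M₁]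
  [RiemannianBundle (fun x : M₁ ↦ TangentSpace I x)]
  {M₂ : Type*} [TopologicalSpace M₂] [ChartedSpace H M₂] [IsManifold I ∞ M₂]
  [RiemannianBundle (fun x : M₂ ↦ TangentSpace I x)]
  [IsContMDiffRiemannianBundle I ∞ (EuclideanSpace ℝ (Fin d)) (fun x : M₂ ↦ TangentSpace I x)]

variable (I) in
/-- The coordinates of a section along `f`, in the charts at `p` and at `f p`. -/
def sectionCoord (f : M₁ → M₂) (ξ : ∀ x, TangentSpace I (f x)) (p : M₁)
    (y : EuclideanSpace ℝ (Fin d)) : EuclideanSpace ℝ (Fin d) :=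
  coords I (f p) (f ((extChartAt I p).symm y)) (ξ ((extChartAt I p).symm y))

variable (I) in
/-- A section along `f` is differentiable at `p` if its coordinates are. -/
def DifferentiableSectionAt (f : M₁ → M₂) (ξ : ∀ x, TangentSpace I (f x)) (p : M₁) : Prop :=
  DifferentiableWithinAt ℝ (sectionCoord I f ξ p) (Set.range I) (extChartAt I p p)

lemma sectionCoord_self (f : M₁ → M₂) (ξ : ∀ x, TangentSpace I (f x)) (p : M₁) :
    sectionCoord I f ξ p (extChartAt I p p) = coords I (f p) (f p) (ξ p) := by
  have hp : (extChartAt I p).symm (extChartAt I p p) = p := extChartAt_to_inv p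
  unfold sectionCoord
  rw [hp]

lemma covDerivAlong_eq {f : M₁ → M₂} {ξ : ∀ x, TangentSpace I (f x)} {p : M₁}
    (hξ : DifferentiableSectionAt I f ξ p) (v : TangentSpace I p) :
    covDerivAlong I f ξ p v = coordFieldL I (f p) (f p)
      (fderivWithin ℝ (sectionCoord I f ξ p) (Set.range I) (extChartAt I p p) (coords I p p v)) +
      christoffelL I (f p) (ξ p) (mfderiv I I f p v) := by
  have h := mdifferentiableAt_iff_coord (I := I) (p := p)
    (h := fun x ↦ coords I (f p) (f x) (ξ x)) |>.2 hξ
  have h2 := mfderiv_apply_eq_fderivWithin h v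
  refine congrArg₂ (· + ·) ?_ rfl
  exact congrArg (coordFieldL I (f p) (f p)) h2

/-- Compatibility of the pullback connection with the metric. -/
lemma mfderiv_inner_eq {f : M₁ → M₂} {ξ η : ∀ x, TangentSpace I (f x)} {p : M₁}
    (hf : MDifferentiableAt I I f p)
    (hξ : DifferentiableSectionAt I f ξ p) (hη : DifferentiableSectionAt I f η p) :
    MDifferentiableAt I 𝓘(ℝ, ℝ) (fun x ↦ inner ℝ (ξ x) (η x)) p ∧ ∀ v : TangentSpace I p,
    mfderiv I 𝓘(ℝ, ℝ) (fun x ↦ inner ℝ (ξ x) (η x)) p v =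
      inner ℝ (covDerivAlong I f ξ p v) (η p) + inner ℝ (ξ p) (covDerivAlong I f η p v) := by
  set y₀ := extChartAt I p p with hy₀
  have hp : (extChartAt I p).symm y₀ = p := extChartAt_to_inv p
  set F := extChartAt I (f p) ∘ f ∘ (extChartAt I p).symm with hFdef
  have hF := hasFDerivWithinAt_writtenInCharts (a := p) (b := f p) hf (mem_chart_source H p)
    (mem_chart_source H (f p))
  have hFy : F y₀ = extChartAt I (f p) (f p) := by
    simp only [F, Function.comp_apply, hp]
  have hmet := differentiableWithinAt_metricCoord (I := I) (mem_extChartAt_target (f p))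
  rw [← hFy] at hmet
  obtain ⟨D, hinner, hD⟩ := hasFDerivWithinAt_bilinear_comp hmet hF (fun y _ ↦ ⟨_, rfl⟩)
    hξ.hasFDerivWithinAt hη.hasFDerivWithinAt
  -- The coordinate expression of the inner product is valid only where f lands in the chart at f p,
  -- hence near y₀.
  have heq : (fun x ↦ inner ℝ (ξ x) (η x)) ∘ (extChartAt I p).symm =ᶠ[𝓝[Set.range I] y₀]
      fun y ↦ metricCoord I (f p) (F y) (sectionCoord I f ξ p y) (sectionCoord I f η p y) := by
    have hcont : ContinuousWithinAt (f ∘ (extChartAt I p).symm) (Set.range I) y₀ := by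
      refine ContinuousAt.comp_continuousWithinAt (f := (extChartAt I p).symm) ?_
        (continuousAt_extChartAt_symm p).continuousWithinAt
      rw [hp]; exact hf.continuousAt
    have := hcont.preimage_mem_nhdsWithin
      ((chartAt H (f p)).open_source.mem_nhds
        (by rw [Function.comp_apply, hp]; exact mem_chart_source H (f p)))
    filter_upwards [this] with y hy
    exact inner_eq_metricCoord (I := I) (q := f p) hy _ _
  have heq0 := heq.eq_of_nhdsWithin ⟨_, rfl⟩
  have hfin := hinner.congr_of_eventuallyEq heq heq0
  have hmd : MDifferentiableAt I 𝓘(ℝ, ℝ) (fun x ↦ inner ℝ (ξ x) (η x)) p :=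
    mdifferentiableAt_iff_coord.2 hfin.differentiableWithinAt
  refine ⟨hmd, fun v ↦ ?_⟩
  rw [mfderiv_apply_eq_fderivWithin hmd, hfin.fderivWithin (uniqueDiffWithinAt_coord p p),
    covDerivAlong_eq hξ, covDerivAlong_eq hη, inner_add_left, inner_add_right]
  have h1 : ∀ u, inner ℝ (coordFieldL I (f p) (f p) u) (η p) = metricCoord I (f p) (F y₀) u
      (sectionCoord I f η p y₀) := fun u ↦ by
    rw [inner_eq_metricCoord (mem_chart_source H (f p)),
      coords_coordFieldL (mem_chart_source H (f p)), hFy, sectionCoord_self]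
  have h2 : ∀ u, inner ℝ (ξ p) (coordFieldL I (f p) (f p) u) = metricCoord I (f p) (F y₀)
      (sectionCoord I f ξ p y₀) u := fun u ↦ by
    rw [inner_eq_metricCoord (mem_chart_source H (f p)),
      coords_coordFieldL (mem_chart_source H (f p)), hFy, sectionCoord_self]
  -- The derivative of the metric in the direction df v is exactly what the two Christoffel terms
  -- supply.
  have h3 := inner_christoffel_add (f p) (mfderiv I I f p v) (ξ p) (η p)
  rw [metricDeriv_eq] at h3
  change inner ℝ (christoffelL I (f p) (ξ p) (mfderiv I I f p v)) (η p) +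
    inner ℝ (ξ p) (christoffelL I (f p) (η p) (mfderiv I I f p v)) = _ at h3
  rw [h1, h2]
  rw [hD]
  simp only [ContinuousLinearMap.comp_apply, coordFieldL_coords (mem_chart_source H p)]
  rw [hFy, sectionCoord_self, sectionCoord_self]
  have h4 {a b x y z : ℝ} (h : x + y = z) : z + a + b = a + x + (b + y) := by
    rw [← h]; ring
  exact h4 h3

end Along

/-! ### The cofactor in coordinates -/

lemma contDiff_clm_det {E : Type*} [NormedAddCommGroup E] [NormedSpace ℝ E]
    [FiniteDimensional ℝ E] {n : WithTop ℕ∞} : ContDiff ℝ n (fun A : E →L[ℝ] E ↦ A.det) := by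
  let b := Module.finBasis ℝ E
  let c (i j : Fin (finrank ℝ E)) : (E →L[ℝ] E) →L[ℝ] ℝ :=
    LinearMap.toContinuousLinearMap (b.coord i) ∘L ContinuousLinearMap.apply ℝ E (b j)
  have hc (A : E →L[ℝ] E) : A.det =
      ∑ σ : Equiv.Perm (Fin (finrank ℝ E)), (Equiv.Perm.sign σ : ℝ) * ∏ i, c (σ i) i A := by
    rw [ContinuousLinearMap.det, ← LinearMap.det_toMatrix b, Matrix.det_apply']
    simp [c, LinearMap.toMatrix_apply]
  simp_rw [hc]
  exact ContDiff.sum fun σ _ ↦ contDiff_const.mul (contDiff_prod fun i _ ↦ (c (σ i) i).contDiff)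

section Along

set_option linter.unusedSectionVars false

variable {d : ℕ} {H : Type*} [TopologicalSpace H]
  {I : ModelWithCorners ℝ (EuclideanSpace ℝ (Fin d)) H}
  {M₁ : Type*} [TopologicalSpace M₁] [ChartedSpace H M₁] [IsManifold I ∞ M₁]
  [RiemannianBundle (fun x : M₁ ↦ TangentSpace I x)]
  {M₂ : Type*} [TopologicalSpace M₂] [ChartedSpace H M₂] [IsManifold I ∞ M₂]
  [RiemannianBundle (fun x : M₂ ↦ TangentSpace I x)]

/-- The vector field dual to the one-form `v ↦ ⟨Cof df v, ξ⟩`. -/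
def cofField (o₁ : ManifoldOrientation I M₁) (o₂ : ManifoldOrientation I M₂) (f : M₁ → M₂)
    (ξ : ∀ x, TangentSpace I (f x)) (x : M₁) : TangentSpace I x :=
  LinearMap.adjoint (cofDifferential o₁ o₂ f x) (ξ x)

variable {o₁ : ManifoldOrientation I M₁} {o₂ : ManifoldOrientation I M₂} {f : M₁ → M₂}

/-- Two top-degree forms are compared on one basis, the coordinate frame at x. Dividing by s₁ is
multiplying by it, since s₁² = 1. -/
lemma volumeForm_comp_mfderiv {x a : M₁} {b : M₂} (hx : x ∈ (chartAt H a).source)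
    (hfx : f x ∈ (chartAt H b).source) {s₁ s₂ : ℝ} (hs₁ : s₁ * s₁ = 1)
    (h₁ : (o₁.at' x).volumeForm (coordFrame I a x) = s₁ * density I a (extChartAt I a x))
    (h₂ : (o₂.at' (f x)).volumeForm (coordFrame I b (f x)) =
      s₂ * density I b (extChartAt I b (f x))) :
    (o₂.at' (f x)).volumeForm.compLinearMap
        (mfderiv I I f x : TangentSpace I x →ₗ[ℝ] TangentSpace I (f x)) =
      (s₁ * s₂ * (coords I b (f x) ∘L mfderiv I I f x ∘L coordFieldL I a x).det *
        density I b (extChartAt I b (f x)) / density I a (extChartAt I a x)) •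
        (o₁.at' x).volumeForm := by
  have hρ := (density_pos (I := I) hx).ne'
  have hdet := alternatingMap_apply_comp (o₂.at' (f x)).volumeForm
    (coordFieldL I b (f x)).toLinearMap
    (coords I b (f x) ∘L mfderiv I I f x ∘L coordFieldL I a x).toLinearMap
  have hleft : ((o₂.at' (f x)).volumeForm.compLinearMap
      (mfderiv I I f x : TangentSpace I x →ₗ[ℝ] TangentSpace I (f x))) (coordFrame I a x) =
      (coords I b (f x) ∘L mfderiv I I f x ∘L coordFieldL I a x).det *
        (s₂ * density I b (extChartAt I b (f x))) := by
    rw [← h₂]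
    refine Eq.trans ?_ hdet
    rw [AlternatingMap.compLinearMap_apply]
    congr 1
    funext i
    exact (coordFieldL_coords hfx _).symm
  rw [((o₂.at' (f x)).volumeForm.compLinearMap _).eq_smul_basis_det (coordBasis I a x hx),
    (o₁.at' x).volumeForm.eq_smul_basis_det (coordBasis I a x hx), coe_coordBasis, hleft, h₁,
    smul_smul]
  congr 1
  field_simp
  linear_combination -(coords I b (f x) ∘L mfderiv I I f x ∘L coordFieldL I a x).det *
    s₂ * density I b (extChartAt I b (f x)) * hs₁

/-- This is (Cof df)* ∘ df = Det(df) · id, the only property of the cofactor used from here on. -/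
lemma adjoint_cof_apply (hd : d ≠ 0) {x : M₁} {c : ℝ}
    (h : (o₂.at' (f x)).volumeForm.compLinearMap
        (mfderiv I I f x : TangentSpace I x →ₗ[ℝ] TangentSpace I (f x)) =
      c • (o₁.at' x).volumeForm) (w : TangentSpace I x) :
    LinearMap.adjoint (cofDifferential o₁ o₂ f x) (mfderiv I I f x w) = c • w := by
  refine ext_inner_left ℝ fun v ↦ ?_
  rw [LinearMap.adjoint_inner_right, inner_smul_right]
  exact inner_cof_apply (o₁.at' x) (o₂.at' (f x)) hd h v w

/-- The density ρ₁ cancels the 1/ρ₁ in Det df. What remains is the Piola transform det A · A⁻¹ v of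
v = ρ₂ ξ, the shape treated by `hasFDerivWithinAt_det_smul_inverse`. -/
lemma density_smul_coords_cofField (hd : d ≠ 0) {x a : M₁} {b : M₂}
    (hx : x ∈ (chartAt H a).source)
    (hfx : f x ∈ (chartAt H b).source) {s₁ s₂ : ℝ} (hs₁ : s₁ * s₁ = 1)
    (h₁ : (o₁.at' x).volumeForm (coordFrame I a x) = s₁ * density I a (extChartAt I a x))
    (h₂ : (o₂.at' (f x)).volumeForm (coordFrame I b (f x)) =
      s₂ * density I b (extChartAt I b (f x)))
    (e : TangentSpace I x ≃L[ℝ] TangentSpace I (f x)) (he : ↑e = mfderiv I I f x)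
    (ξ : ∀ x, TangentSpace I (f x)) :
    density I a (extChartAt I a x) • coords I a x (cofField o₁ o₂ f ξ x) =
      (s₁ * s₂) • ((coords I b (f x) ∘L mfderiv I I f x ∘L coordFieldL I a x).det •
        (coords I b (f x) ∘L mfderiv I I f x ∘L coordFieldL I a x).inverse
          (density I b (extChartAt I b (f x)) • coords I b (f x) (ξ x))) := by
  have hρ := (density_pos (I := I) hx).ne'
  have hadj := adjoint_cof_apply hd (volumeForm_comp_mfderiv hx hfx hs₁ h₁ h₂) (e.symm (ξ x))
  have hdf : mfderiv I I f x (e.symm (ξ x)) = ξ x := by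
    rw [← he]; exact e.apply_symm_apply _
  rw [hdf] at hadj
  let A : EuclideanSpace ℝ (Fin d) ≃L[ℝ] EuclideanSpace ℝ (Fin d) :=
    ((coordsEquiv I a x hx).trans e).trans (coordsEquiv I b (f x) hfx).symm
  have hA : coords I b (f x) ∘L mfderiv I I f x ∘L coordFieldL I a x = A := by
    rw [← he]; rfl
  have hinv : (coords I b (f x) ∘L mfderiv I I f x ∘L coordFieldL I a x).inverse
      (coords I b (f x) (ξ x)) = coords I a x (e.symm (ξ x)) := by
    rw [hA, ContinuousLinearMap.inverse_equiv]
    change A.symm _ = _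
    rw [ContinuousLinearEquiv.symm_apply_eq]
    have : A (coords I a x (e.symm (ξ x))) =
        coords I b (f x) (e (coordFieldL I a x (coords I a x (e.symm (ξ x))))) := rfl
    rw [this, coordFieldL_coords hx, e.apply_symm_apply]
  rw [cofField, hadj, map_smul, map_smul, hinv, smul_smul, smul_smul, smul_smul]
  congr 1
  field_simp

end Along

/-! ### The pointwise Piola identity -/

section Along

set_option linter.unusedSectionVars false

variable {d : ℕ} {H : Type*} [TopologicalSpace H]
  {I : ModelWithCorners ℝ (EuclideanSpace ℝ (Fin d)) H}
  {M₁ : Type*} [TopologicalSpace M₁] [ChartedSpace H M₁] [IsManifold I ∞ M₁]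
  [RiemannianBundle (fun x : M₁ ↦ TangentSpace I x)]
  {M₂ : Type*} [TopologicalSpace M₂] [ChartedSpace H M₂] [IsManifold I ∞ M₂]
  [RiemannianBundle (fun x : M₂ ↦ TangentSpace I x)]

lemma eventually_nhdsWithin_extChartAt_symm {q x : M₁} (hx : x ∈ (chartAt H q).source)
    {P : M₁ → Prop} (hP : ∀ᶠ z in 𝓝 x, P z) :
    ∀ᶠ y in 𝓝[Set.range I] (extChartAt I q x), P ((extChartAt I q).symm y) := by
  have hx' : x ∈ (extChartAt I q).source := by simpa using hx
  have h : Filter.Tendsto (extChartAt I q).symm (𝓝[Set.range I] (extChartAt I q x)) (𝓝 x) := by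
    have := (continuousAt_extChartAt_symm' (I := I) hx').tendsto
    rw [(extChartAt I q).left_inv hx'] at this
    exact this.mono_left nhdsWithin_le_nhds
  exact h.eventually hP

variable (I) in
/-- The coordinates, times the density, of a vector field in the chart at `q`. -/
def densityCoord (W : ∀ x : M₁, TangentSpace I x) (q : M₁) (y : EuclideanSpace ℝ (Fin d)) :
    EuclideanSpace ℝ (Fin d) :=
  density I q y • coords I q ((extChartAt I q).symm y) (W ((extChartAt I q).symm y))

variable (I) in
/-- The divergence of a vector field at `x`, computed in the chart at `q`. -/
def chartDiv (W : ∀ x : M₁, TangentSpace I x) (q x : M₁) : ℝ :=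
  (density I q (extChartAt I q x))⁻¹ * LinearMap.trace ℝ (EuclideanSpace ℝ (Fin d))
    (fderivWithin ℝ (densityCoord I W q) (Set.range I) (extChartAt I q x)).toLinearMap

lemma innerHom_eq_trace (x : M₁) {V : Type*} [NormedAddCommGroup V] [InnerProductSpace ℝ V]
    [FiniteDimensional ℝ V] (A B : TangentSpace I x →ₗ[ℝ] V) :
    innerHom A B = LinearMap.trace ℝ _ (LinearMap.adjoint A ∘ₗ B) := by
  rw [LinearMap.trace_eq_sum_inner _ (stdOrthonormalBasis ℝ (TangentSpace I x))]
  simp [innerHom, LinearMap.adjoint_inner_right]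

section Divergence

variable [IsContMDiffRiemannianBundle I ∞ (EuclideanSpace ℝ (Fin d))
  (fun x : M₁ ↦ TangentSpace I x)]

/-- The trace of the covariant derivative of a vector field is its divergence in coordinates. -/
lemma sum_inner_covDerivAlong_id {W : ∀ x : M₁, TangentSpace I x} {p : M₁}
    (hW : DifferentiableSectionAt I (fun x : M₁ ↦ x) W p) :
    ∑ i, inner ℝ (stdOrthonormalBasis ℝ (TangentSpace I p) i)
        (covDerivAlong I (fun x : M₁ ↦ x) W p (stdOrthonormalBasis ℝ (TangentSpace I p) i)) =
      chartDiv I W p p := by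
  set y₀ := extChartAt I p p with hy₀
  have hpS := mem_chart_source H p
  have hρ : 0 < density I p y₀ := density_pos hpS
  set X := fderivWithin ℝ (sectionCoord I (fun x : M₁ ↦ x) W p) (Set.range I) y₀ with hX
  have hWd : HasFDerivWithinAt (sectionCoord I (fun x : M₁ ↦ x) W p) X (Set.range I) y₀ :=
    hW.hasFDerivWithinAt
  set R := fderivWithin ℝ (density I p) (Set.range I) y₀ with hR
  have hRd : HasFDerivWithinAt (density I p) R (Set.range I) y₀ :=
    ((contDiffWithinAt_density (I := I) (mem_extChartAt_target (I := I) p)).differentiableWithinAt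
      (by simp)).hasFDerivWithinAt
  have hV : HasFDerivWithinAt (densityCoord I W p)
      (density I p y₀ • X + R.smulRight (sectionCoord I (fun x : M₁ ↦ x) W p y₀))
      (Set.range I) y₀ :=
    hRd.smul hWd
  have hconn : covDerivAlong I (fun x : M₁ ↦ x) W p =
      ⇑((coordFieldL I p p).toLinearMap ∘ₗ X.toLinearMap ∘ₗ (coords I p p).toLinearMap +
        christoffelL I p (W p)) := by
    funext v
    have h := covDerivAlong_eq hW v
    have hid : mfderiv I I (fun x : M₁ ↦ x) p v = v := by
      have : (fun x : M₁ ↦ x) = id := rfl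
      rw [this, mfderiv_id]; rfl
    rw [hid] at h
    exact h
  have h1 : LinearMap.trace ℝ _ ((coordFieldL I p p).toLinearMap ∘ₗ X.toLinearMap ∘ₗ
      (coords I p p).toLinearMap) = LinearMap.trace ℝ _ X.toLinearMap := by
    have := LinearMap.trace_comp_comm' (R := ℝ) (coords I p p).toLinearMap
      ((coordFieldL I p p).toLinearMap ∘ₗ X.toLinearMap)
    refine this.trans (congrArg _ ?_)
    ext1 w
    exact coords_coordFieldL hpS _
  -- The Christoffel part of the trace is the term of div(ρW) in which ρ is differentiated.
  have h3 : density I p y₀ * LinearMap.trace ℝ _ (christoffelL I p (W p)) =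
      R (sectionCoord I (fun x : M₁ ↦ x) W p y₀) := by
    rw [hy₀, sectionCoord_self]
    exact density_mul_trace_christoffelL p (W p)
  have htr : LinearMap.trace ℝ _ (density I p y₀ • X + R.smulRight
      (sectionCoord I (fun x : M₁ ↦ x) W p y₀)).toLinearMap =
      density I p y₀ * LinearMap.trace ℝ _ X.toLinearMap +
        R (sectionCoord I (fun x : M₁ ↦ x) W p y₀) := by
    rw [ContinuousLinearMap.toLinearMap_add, ContinuousLinearMap.toLinearMap_smul, map_add,
      map_smul, smul_eq_mul]
    exact congrArg _ (LinearMap.trace_smulRight R.toLinearMap _)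
  rw [chartDiv, ← hy₀, hV.fderivWithin (uniqueDiffWithinAt_coord p p), htr, ← h3, hconn,
    ← LinearMap.trace_eq_sum_inner _ (stdOrthonormalBasis ℝ (TangentSpace I p)), map_add, h1]
  field_simp

end Divergence

variable [IsContMDiffRiemannianBundle I ∞ (EuclideanSpace ℝ (Fin d))
  (fun x : M₁ ↦ TangentSpace I x)]
  [IsContMDiffRiemannianBundle I ∞ (EuclideanSpace ℝ (Fin d)) (fun x : M₂ ↦ TangentSpace I x)]
  {o₁ : ManifoldOrientation I M₁} {o₂ : ManifoldOrientation I M₂} {f : M₁ → M₂}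

/-- The heart of the proof: div((Cof df)* ξ) contains no derivative of Cof df, by the Piola identity
in coordinates, so only the terms of ∇ξ are left. The regularity statement holds because A = DF is
C¹ for f of class C². It makes the divergence theorem and the product rule available for this field.
-/
theorem innerHom_cof_covDerivAlong (hd : d ≠ 0) (hf : IsLocalDiffeomorph I I 2 f)
    {ξ : ∀ x, TangentSpace I (f x)} {p : M₁}
    (hξ : ContDiffWithinAt ℝ 1 (sectionCoord I f ξ p) (Set.range I) (extChartAt I p p)) :
    ContDiffWithinAt ℝ 1 (sectionCoord I (fun x : M₁ ↦ x) (cofField o₁ o₂ f ξ) p) (Set.range I)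
      (extChartAt I p p) ∧
    innerHom (cofDifferential o₁ o₂ f p) (covDerivAlong I f ξ p) =
      chartDiv I (cofField o₁ o₂ f ξ) p p := by
  set y₀ := extChartAt I p p with hy₀
  have hp : (extChartAt I p).symm y₀ = p := extChartAt_to_inv p
  have hpS := mem_chart_source H p
  have hfpS := mem_chart_source H (f p)
  set F := extChartAt I (f p) ∘ f ∘ (extChartAt I p).symm with hFdef
  set A := fderivWithin ℝ F (Set.range I) with hA
  have hy₀S : y₀ ∈ Set.range I := ⟨_, rfl⟩
  have hFy : F y₀ = extChartAt I (f p) (f p) := by simp only [F, Function.comp_apply, hp]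
  have hFC : ContDiffWithinAt ℝ 2 F (Set.range I) y₀ := (contMDiffAt_iff.1 (hf.contMDiff p)).2
  have hAC : ContDiffWithinAt ℝ 1 A (Set.range I) y₀ :=
    hFC.fderivWithin_right I.uniqueDiffOn (by norm_num) hy₀S
  have hmd := hf.mdifferentiable (by norm_num)
  -- the derivative in coordinates
  have hAeq {x : M₁} (hx : x ∈ (chartAt H p).source) (hfx : f x ∈ (chartAt H (f p)).source) :
      A (extChartAt I p x) = coords I (f p) (f x) ∘L mfderiv I I f x ∘L coordFieldL I p x :=
    (hasFDerivWithinAt_writtenInCharts (hmd x) hx hfx).fderivWithin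
      (uniqueDiffWithinAt_coord p x)
  let e (x : M₁) := hf.mfderivToContinuousLinearEquiv (by norm_num) x
  have he (x : M₁) : ((e x : TangentSpace I x ≃L[ℝ] TangentSpace I (f x)) :
      TangentSpace I x →L[ℝ] TangentSpace I (f x)) = mfderiv I I f x := rfl
  let A₀ : EuclideanSpace ℝ (Fin d) ≃L[ℝ] EuclideanSpace ℝ (Fin d) :=
    ((coordsEquiv I p p hpS).trans (e p)).trans (coordsEquiv I (f p) (f p) hfpS).symm
  have hA₀ : A y₀ = A₀ := (hAeq hpS hfpS).trans rfl
  have hAinv : (A y₀).IsInvertible := ⟨A₀, hA₀.symm⟩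
  obtain ⟨s₁, hs₁, hv₁⟩ := exists_sign_volumeForm_coordFrame hd o₁ p
  obtain ⟨s₂, hs₂, hv₂⟩ := exists_sign_volumeForm_coordFrame hd o₂ (f p)
  -- the vector field in coordinates
  have hloc : densityCoord I (cofField o₁ o₂ f ξ) p =ᶠ[𝓝[Set.range I] y₀]
      fun y ↦ (s₁ * s₂) • ((A y).det • (A y).inverse
        (density I (f p) (F y) • sectionCoord I f ξ p y)) := by
    have h1 := (hf.contMDiff p).continuousAt.eventually hv₂
    have h2 := (hf.contMDiff p).continuousAt.preimage_mem_nhds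
      ((chartAt H (f p)).open_source.mem_nhds hfpS)
    have h3 := (chartAt H p).open_source.mem_nhds hpS
    filter_upwards [eventually_nhdsWithin_extChartAt_symm hpS (hv₁.and (h1.and
      (Filter.Eventually.and h2 h3))), extChartAt_target_mem_nhdsWithin (I := I) p] with y hy hyt
    obtain ⟨hy1, hy2, hy3, hy4⟩ := hy
    have h := density_smul_coords_cofField hd hy4 hy3 hs₁ hy1 hy2 (e _) (he _) ξ
    rw [← hAeq hy4 hy3] at h
    rw [(extChartAt I p).right_inv hyt] at h
    exact h
  have hloc₀ := hloc.eq_of_nhdsWithin hy₀S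
  have hρ₂C : ContDiffWithinAt ℝ 1 (fun y ↦ density I (f p) (F y)) (Set.range I) y₀ := by
    have h := contDiffWithinAt_density (I := I) (mem_extChartAt_target (I := I) (f p))
    rw [← hFy] at h
    exact (h.of_le (by simp)).comp y₀ (hFC.of_le (by norm_num)) (fun y _ ↦ ⟨_, rfl⟩)
  have hvC : ContDiffWithinAt ℝ 1 (fun y ↦ density I (f p) (F y) • sectionCoord I f ξ p y)
      (Set.range I) y₀ := hρ₂C.smul hξ
  have hinvC : ContDiffWithinAt ℝ 1 (fun y ↦ (A y).inverse) (Set.range I) y₀ :=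
    (hAinv.contDiffAt_map_inverse (n := 1)).comp_contDiffWithinAt y₀ hAC
  have hdetC : ContDiffWithinAt ℝ 1 (fun y ↦ (A y).det) (Set.range I) y₀ :=
    (contDiff_clm_det.contDiffAt).comp_contDiffWithinAt y₀ hAC
  have hVC : ContDiffWithinAt ℝ 1 (densityCoord I (cofField o₁ o₂ f ξ) p) (Set.range I) y₀ :=
    ((hdetC.smul (hinvC.clm_apply hvC)).const_smul (s₁ * s₂)).congr_of_eventuallyEq hloc hloc₀
  have hρ₁ : 0 < density I p y₀ := density_pos hpS
  refine ⟨?_, ?_⟩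
  · have h := ((contDiffWithinAt_density (I := I) (mem_extChartAt_target p)).of_le
      (by simp : (1 : WithTop ℕ∞) ≤ ∞)).inv hρ₁.ne'
    have hdiv {y : EuclideanSpace ℝ (Fin d)} (hy : y ∈ (extChartAt I p).target) :
        sectionCoord I (fun x : M₁ ↦ x) (cofField o₁ o₂ f ξ) p y =
          ((density I p)⁻¹ • densityCoord I (cofField o₁ o₂ f ξ) p) y := by
      rw [Pi.smul_apply', Pi.inv_apply, densityCoord, smul_smul,
        inv_mul_cancel₀ (density_pos' hy).ne', one_smul]
      rfl
    refine (h.smul hVC).congr_of_eventuallyEq ?_ (hdiv (mem_extChartAt_target p))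
    filter_upwards [extChartAt_target_mem_nhdsWithin (I := I) p] with y hy using hdiv hy
  · have hρ₂ : 0 < density I (f p) (F y₀) := by rw [hFy]; exact density_pos hfpS
    have hξd := (hξ.differentiableWithinAt one_ne_zero).hasFDerivWithinAt
    set X := fderivWithin ℝ (sectionCoord I f ξ p) (Set.range I) y₀ with hX
    set R := fderivWithin ℝ (density I (f p)) (Set.range I) (F y₀) with hR
    have hRd : HasFDerivWithinAt (density I (f p)) R (Set.range I) (F y₀) := by
      have h := contDiffWithinAt_density (I := I) (mem_extChartAt_target (I := I) (f p))
      rw [← hFy] at h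
      exact (h.differentiableWithinAt (by simp)).hasFDerivWithinAt
    have hFd : HasFDerivWithinAt F (A y₀) (Set.range I) y₀ :=
      (hFC.differentiableWithinAt (by norm_num)).hasFDerivWithinAt
    have hvd := HasFDerivWithinAt.smul (hRd.comp y₀ hFd (fun y _ ↦ ⟨_, rfl⟩)) hξd
    obtain ⟨V', hV', htr⟩ := hasFDerivWithinAt_det_smul_inverse I.uniqueDiffOn hy₀S
      (I.range_subset_closure_interior hy₀S) hFC hAinv hvd
    have hV := (hV'.const_smul (s₁ * s₂)).congr_of_eventuallyEq hloc hloc₀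
    rw [chartDiv, ← hy₀, hV.fderivWithin (uniqueDiffWithinAt_coord p p)]
    have hAi : (A y₀).inverse = A₀.symm := by rw [hA₀, ContinuousLinearMap.inverse_equiv]
    -- The part that differentiates ρ₂ has rank one: A⁻¹ ξ tensored with R ∘ A has trace R(ξ).
    have htrace : LinearMap.trace ℝ _ ((A y₀).inverse ∘L (density I (f p) (F y₀) • X +
        (R ∘L A y₀).smulRight (sectionCoord I f ξ p y₀)) :
        EuclideanSpace ℝ (Fin d) →L[ℝ] EuclideanSpace ℝ (Fin d)).toLinearMap =
        density I (f p) (F y₀) * LinearMap.trace ℝ _ (A₀.symm.toLinearMap ∘ₗ X.toLinearMap) +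
        R (sectionCoord I f ξ p y₀) := by
      rw [hAi, hA₀]
      have : ((A₀.symm : EuclideanSpace ℝ (Fin d) →L[ℝ] EuclideanSpace ℝ (Fin d)) ∘L
          (density I (f p) (F y₀) • X + (R ∘L A₀).smulRight (sectionCoord I f ξ p y₀)) :
          EuclideanSpace ℝ (Fin d) →L[ℝ] EuclideanSpace ℝ (Fin d)).toLinearMap =
          density I (f p) (F y₀) • (A₀.symm.toLinearMap ∘ₗ X.toLinearMap) +
          (R.toLinearMap ∘ₗ A₀.toLinearMap).smulRight (A₀.symm (sectionCoord I f ξ p y₀)) := by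
        ext1 w
        simp
      rw [this, map_add, map_smul, LinearMap.trace_smulRight]
      simp
    have hconn : covDerivAlong I f ξ p =
        ⇑((coordFieldL I (f p) (f p)).toLinearMap ∘ₗ X.toLinearMap ∘ₗ (coords I p p).toLinearMap +
          christoffelL I (f p) (ξ p) ∘ₗ (e p).toLinearMap) := by
      funext v
      exact covDerivAlong_eq (hξ.differentiableWithinAt one_ne_zero) v
    rw [hconn, innerHom_eq_trace]
    have hc := volumeForm_comp_mfderiv hpS hfpS hs₁ hv₁.self_of_nhds hv₂.self_of_nhds
    rw [← hAeq hpS hfpS] at hc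
    set c := s₁ * s₂ * (A y₀).det * density I (f p) (extChartAt I (f p) (f p)) /
      density I p y₀ with hcdef
    have hadj : LinearMap.adjoint (cofDifferential o₁ o₂ f p) =
        c • (e p).symm.toLinearMap := by
      ext1 u
      have := adjoint_cof_apply hd hc ((e p).symm u)
      rw [← he p] at this
      exact (congrArg _ ((e p).apply_symm_apply u).symm).trans this
    have h1 : LinearMap.trace ℝ _ ((e p).symm.toLinearMap ∘ₗ (coordFieldL I (f p) (f p)).toLinearMap
        ∘ₗ X.toLinearMap ∘ₗ (coords I p p).toLinearMap) =
        LinearMap.trace ℝ _ (A₀.symm.toLinearMap ∘ₗ X.toLinearMap) := by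
      have := LinearMap.trace_comp_comm' (R := ℝ) (coords I p p).toLinearMap
        ((e p).symm.toLinearMap ∘ₗ (coordFieldL I (f p) (f p)).toLinearMap ∘ₗ X.toLinearMap)
      exact this
    -- The Christoffel term of ∇ξ is Γ(df ·, ξ). Composed with df⁻¹ it is conjugate to Γ(·, ξ) and
    -- has the same trace.
    have h2 : LinearMap.trace ℝ _ ((e p).symm.toLinearMap ∘ₗ christoffelL I (f p) (ξ p) ∘ₗ
        (e p).toLinearMap) = LinearMap.trace ℝ _ (christoffelL I (f p) (ξ p)) :=
      LinearMap.trace_conj' (christoffelL I (f p) (ξ p)) (e p).symm.toLinearEquiv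
    have h3 := density_mul_trace_christoffelL (f p) (ξ p)
    rw [← hFy, ← hR, ← sectionCoord_self] at h3
    have htr' : LinearMap.trace ℝ _ V'.toLinearMap = (A y₀).det * (density I (f p) (F y₀) *
        LinearMap.trace ℝ _ (A₀.symm.toLinearMap ∘ₗ X.toLinearMap) +
        R (sectionCoord I f ξ p y₀)) := htr.trans (congrArg _ htrace)
    rw [hadj, LinearMap.smul_comp, LinearMap.comp_add, map_smul, map_add, h1, h2,
      ContinuousLinearMap.toLinearMap_smul, map_smul, htr', ← h3, hcdef, hFy]
    simp only [smul_eq_mul]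
    field_simp

end Along

/-! ### Differentiability from pairings with a nondegenerate form -/

section Bilinear

variable {X : Type*} [NormedAddCommGroup X] [NormedSpace ℝ X] {d : ℕ}

/-- A vector-valued function is differentiable if its products with a frame are, for a
differentiable family of nondegenerate bilinear forms. -/
lemma differentiableWithinAt_of_bilinear
    {g : X → EuclideanSpace ℝ (Fin d) →L[ℝ] EuclideanSpace ℝ (Fin d) →L[ℝ] ℝ}
    {u : X → EuclideanSpace ℝ (Fin d)} {S : Set X} {x₀ : X} (hx₀ : x₀ ∈ S)
    (hg : DifferentiableWithinAt ℝ g S x₀)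
    (hinj : ∀ᶠ x in 𝓝[S] x₀, Function.Injective (g x))
    (hu : ∀ w, DifferentiableWithinAt ℝ (fun x ↦ g x (u x) w) S x₀) :
    DifferentiableWithinAt ℝ u S x₀ := by
  have hfin : finrank ℝ (EuclideanSpace ℝ (Fin d)) =
      finrank ℝ (EuclideanSpace ℝ (Fin d) →L[ℝ] ℝ) := by
    rw [← LinearMap.toContinuousLinearMap.finrank_eq, Module.finrank_linearMap]
    simp
  have hinv {x : X} (h : Function.Injective (g x)) : (g x).IsInvertible :=
    ⟨(LinearEquiv.ofInjectiveOfFinrankEq (g x).toLinearMap h hfin).toContinuousLinearEquiv, rfl⟩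
  have hm : DifferentiableWithinAt ℝ (fun x ↦ g x (u x)) S x₀ := by
    have h : (fun x ↦ g x (u x)) = fun x ↦ ∑ i, g x (u x) (EuclideanSpace.single i 1) •
        (EuclideanSpace.proj i : EuclideanSpace ℝ (Fin d) →L[ℝ] ℝ) := by
      funext x
      ext w
      have hw : w = ∑ i, w i • EuclideanSpace.single i (1 : ℝ) := by
        conv_lhs => rw [← (EuclideanSpace.basisFun (Fin d) ℝ).sum_repr w]
        simp
      conv_lhs => rw [hw, map_sum]
      simp [mul_comm]
    rw [h]
    exact DifferentiableWithinAt.fun_sum fun i _ ↦ (hu _).smul_const _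
  have h0 := hinv (hinj.self_of_nhdsWithin hx₀)
  have h1 : DifferentiableWithinAt ℝ (fun x ↦ (g x).inverse) S x₀ :=
    ((h0.contDiffAt_map_inverse (n := 1)).differentiableAt
      one_ne_zero).comp_differentiableWithinAt x₀ hg
  -- The vector u is recovered by applying the inverse of g to the functional g(u, ·), and inversion
  -- is smooth.
  have heq {x : X} (h : Function.Injective (g x)) : u x = (g x).inverse (g x (u x)) := by
    obtain ⟨e, he⟩ := hinv h
    rw [← he, ContinuousLinearMap.inverse_equiv]
    simp
  refine (h1.clm_apply hm).congr_of_eventuallyEq ?_ (heq (hinj.self_of_nhdsWithin hx₀))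
  filter_upwards [hinj] with x hx using heq hx

end Bilinear

/-! ### Vanishing of the coderivative at every point -/

section Along

set_option linter.unusedSectionVars false

variable {d : ℕ} {H : Type*} [TopologicalSpace H]
  {I : ModelWithCorners ℝ (EuclideanSpace ℝ (Fin d)) H}
  {M₁ : Type*} [TopologicalSpace M₁] [ChartedSpace H M₁] [IsManifold I ∞ M₁]
  [RiemannianBundle (fun x : M₁ ↦ TangentSpace I x)]
  {M₂ : Type*} [TopologicalSpace M₂] [ChartedSpace H M₂] [IsManifold I ∞ M₂]
  [RiemannianBundle (fun x : M₂ ↦ TangentSpace I x)]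
  [IsContMDiffRiemannianBundle I ∞ (EuclideanSpace ℝ (Fin d)) (fun x : M₂ ↦ TangentSpace I x)]

lemma eventually_map_extChartAt_symm_mem_source {f : M₁ → M₂} {p : M₁} (hf : ContinuousAt f p) :
    ∀ᶠ y in 𝓝[Set.range I] (extChartAt I p p),
      f ((extChartAt I p).symm y) ∈ (chartAt H (f p)).source :=
  eventually_nhdsWithin_extChartAt_symm (mem_chart_source H p)
    (hf.preimage_mem_nhds ((chartAt H (f p)).open_source.mem_nhds (mem_chart_source H (f p))))

lemma injective_metricCoord {q : M₁} {x : M₁} (hx : x ∈ (chartAt H q).source) :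
    Function.Injective (metricCoord I q (extChartAt I q x)) := by
  refine (injective_iff_map_eq_zero _).2 fun u hu ↦ ?_
  have h := inner_eq_metricCoord hx (coordFieldL I q x u) (coordFieldL I q x u)
  rw [coords_coordFieldL hx, hu] at h
  have h0 : coordFieldL I q x u = 0 := inner_self_eq_zero.1 (h.trans rfl)
  rw [← coords_coordFieldL (I := I) hx u, h0, map_zero]

lemma contDiffWithinAt_sectionCoord_coordField {f : M₁ → M₂} {p : M₁} (hf : ContinuousAt f p)
    (u : EuclideanSpace ℝ (Fin d)) :
    ContDiffWithinAt ℝ 1 (sectionCoord I f (fun x ↦ coordField I (f p) u (f x)) p) (Set.range I)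
      (extChartAt I p p) := by
  refine (contDiffWithinAt_const (c := u)).congr_of_eventuallyEq ?_ ?_
  · filter_upwards [eventually_map_extChartAt_symm_mem_source hf] with y hy
    exact coords_coordFieldL hy u
  · rw [sectionCoord_self]
    exact coords_coordFieldL (mem_chart_source H (f p)) u

/-- A section is differentiable if its products with the coordinate fields are. -/
lemma differentiableSectionAt_of_inner {f : M₁ → M₂} {p : M₁} (hf : MDifferentiableAt I I f p)
    {ξ : ∀ x, TangentSpace I (f x)}
    (h : ∀ u, MDifferentiableAt I 𝓘(ℝ, ℝ)
      (fun x ↦ inner ℝ (ξ x) (coordField I (f p) u (f x))) p) :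
    DifferentiableSectionAt I f ξ p := by
  set y₀ := extChartAt I p p with hy₀
  have hp : (extChartAt I p).symm y₀ = p := extChartAt_to_inv p
  set F := extChartAt I (f p) ∘ f ∘ (extChartAt I p).symm with hFdef
  have hF : HasFDerivWithinAt F _ (Set.range I) y₀ := hasFDerivWithinAt_writtenInCharts (a := p)
    (b := f p) hf (mem_chart_source H p) (mem_chart_source H (f p))
  have hFy : F y₀ = extChartAt I (f p) (f p) := by simp only [F, Function.comp_apply, hp]
  have hmet := differentiableWithinAt_metricCoord (I := I) (mem_extChartAt_target (f p))
  rw [← hFy] at hmet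
  have hg : DifferentiableWithinAt ℝ (metricCoord I (f p) ∘ F) (Set.range I) y₀ :=
    hmet.comp y₀ hF.differentiableWithinAt (fun y _ ↦ ⟨_, rfl⟩)
  have hy₀S : y₀ ∈ Set.range I := ⟨_, rfl⟩
  refine differentiableWithinAt_of_bilinear hy₀S hg ?_ fun w ↦ ?_
  · filter_upwards [eventually_map_extChartAt_symm_mem_source hf.continuousAt] with y hy
    exact injective_metricCoord hy
  · have h1 := mdifferentiableAt_iff_coord.1 (h w)
    have heq : (fun y ↦ (metricCoord I (f p) ∘ F) y (sectionCoord I f ξ p y) w)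
        =ᶠ[𝓝[Set.range I] y₀] (fun x ↦ inner ℝ (ξ x) (coordField I (f p) w (f x))) ∘
          (extChartAt I p).symm := by
      filter_upwards [eventually_map_extChartAt_symm_mem_source hf.continuousAt] with y hy
      rw [Function.comp_apply, Function.comp_apply, inner_eq_metricCoord hy, ← coordFieldL_apply,
        coords_coordFieldL hy]
      rfl
    exact h1.congr_of_eventuallyEq heq (heq.self_of_nhdsWithin hy₀S)

variable [IsContMDiffRiemannianBundle I ∞ (EuclideanSpace ℝ (Fin d))
  (fun x : M₁ ↦ TangentSpace I x)]
  {o₁ : ManifoldOrientation I M₁} {o₂ : ManifoldOrientation I M₂} {f : M₁ → M₂}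

/-- The pointwise Piola identity. -/
theorem coderivative_cofDifferential (hd : d ≠ 0) (hf : IsLocalDiffeomorph I I 2 f) (p : M₁) :
    coderivative I f (cofDifferential o₁ o₂ f) p = 0 := by
  have hmd := hf.mdifferentiable (by norm_num)
  have hid : MDifferentiableAt I I (fun x : M₁ ↦ x) p := mdifferentiableAt_id
  set α := cofDifferential o₁ o₂ f with hα
  -- Z extends a vector of the tangent space at f p to a section along f with constant coordinates
  -- near p.
  let Z (u : EuclideanSpace ℝ (Fin d)) (x : M₁) : TangentSpace I (f x) := coordField I (f p) u (f x)
  have hZ (u : EuclideanSpace ℝ (Fin d)) : ContDiffWithinAt ℝ 1 (sectionCoord I f (Z u) p)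
      (Set.range I) (extChartAt I p p) :=
    contDiffWithinAt_sectionCoord_coordField (hmd p).continuousAt u
  have hZd (u : EuclideanSpace ℝ (Fin d)) : DifferentiableSectionAt I f (Z u) p :=
    (hZ u).differentiableWithinAt one_ne_zero
  have hW (u : EuclideanSpace ℝ (Fin d)) :
      DifferentiableSectionAt I (fun x : M₁ ↦ x) (cofField o₁ o₂ f (Z u)) p :=
    (innerHom_cof_covDerivAlong hd hf (hZ u)).1.differentiableWithinAt one_ne_zero
  have hE (u : EuclideanSpace ℝ (Fin d)) :
      DifferentiableSectionAt I (fun x : M₁ ↦ x) (coordField I p u) p :=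
    (contDiffWithinAt_sectionCoord_coordField (f := fun x : M₁ ↦ x)
      continuousAt_id u).differentiableWithinAt one_ne_zero
  have hadj (u w : EuclideanSpace ℝ (Fin d)) :
      (fun x ↦ inner ℝ (α x (coordField I p u x)) (Z w x)) =
        fun x ↦ inner ℝ (coordField I p u x) (cofField o₁ o₂ f (Z w) x) := by
    funext x
    exact (LinearMap.adjoint_inner_right _ _ _).symm
  -- Pairings of α(E) with the frame Z are pairings of E with the C¹ fields α* Z, so they are
  -- differentiable. Hence so is α(E).
  have hαE (u : EuclideanSpace ℝ (Fin d)) :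
      DifferentiableSectionAt I f (fun x ↦ α x (coordField I p u x)) p := by
    refine differentiableSectionAt_of_inner (hmd p) fun w ↦ ?_
    have := (mfderiv_inner_eq hid (hE u) (hW w)).1
    rw [← hadj] at this
    exact this
  refine ext_inner_right ℝ fun ζ ↦ ?_
  -- The function ⟨α(E), Z⟩ = ⟨E, α* Z⟩ is differentiated in both forms. Subtracting α(∇E), as in
  -- the definition of ∇α, removes the terms with ∇E.
  have hterm (e : TangentSpace I p) : inner ℝ (covDerivForm I f α p e e) ζ =
      inner ℝ e (covDerivAlong I (fun x : M₁ ↦ x) (cofField o₁ o₂ f (Z ζ)) p e) -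
      inner ℝ (α p e) (covDerivAlong I f (Z ζ) p e) := by
    have h1 := (mfderiv_inner_eq (hmd p) (hαE e) (hZd ζ)).2 e
    have h2 := (mfderiv_inner_eq hid (hE e) (hW ζ)).2 e
    have hZp : Z ζ p = ζ := coordFieldL_self (f p) ζ
    have hEp : coordField I p e p = e := coordFieldL_self p e
    have h3 : inner ℝ (α p (covDerivAlong I (fun x : M₁ ↦ x) (coordField I p e) p e)) ζ =
        inner ℝ (covDerivAlong I (fun x : M₁ ↦ x) (coordField I p e) p e)
          (cofField o₁ o₂ f (Z ζ) p) := by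
      rw [cofField, LinearMap.adjoint_inner_right, hZp]
    have hcongr {h h' : M₁ → ℝ} (hh : h = h') {a b : ℝ} (ha : mfderiv I 𝓘(ℝ, ℝ) h p e = a)
        (hb : mfderiv I 𝓘(ℝ, ℝ) h' p e = b) : a = b := by
      subst hh
      exact ha.symm.trans hb
    have h4 := hcongr (hadj e ζ) h1 h2
    rw [hZp, hEp] at h4
    rw [covDerivForm, inner_sub_left, h3]
    linear_combination h4
  -- Summed over an orthonormal basis, the two terms are div(α* Z) and ⟨α, ∇Z⟩, which agree by
  -- `innerHom_cof_covDerivAlong`.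
  have hdiv := sum_inner_covDerivAlong_id (hW ζ)
  have hcof := (innerHom_cof_covDerivAlong (o₁ := o₁) (o₂ := o₂) hd hf (hZ ζ)).2
  rw [← hdiv, innerHom] at hcof
  rw [coderivative, inner_neg_left, sum_inner, Finset.sum_congr rfl fun i _ ↦ hterm _,
    Finset.sum_sub_distrib, ← hcof, sub_self, neg_zero, inner_zero_left]

end Along

/-! ### The divergence does not depend on the chart -/

section Divergence

set_option linter.unusedSectionVars false

variable {d : ℕ} {H : Type*} [TopologicalSpace H]
  {I : ModelWithCorners ℝ (EuclideanSpace ℝ (Fin d)) H}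
  {M : Type*} [TopologicalSpace M] [ChartedSpace H M] [IsManifold I ∞ M]

lemma coords_mfderiv_id_coordFieldL (a b x : M) :
    coords I b x ∘L mfderiv I I (fun x : M ↦ x) x ∘L coordFieldL I a x =
      coords I b x ∘L coordFieldL I a x := by
  have : (fun x : M ↦ x) = id := rfl
  rw [this, mfderiv_id]
  rfl

lemma hasFDerivWithinAt_transition {x a b : M} (ha : x ∈ (chartAt H a).source)
    (hb : x ∈ (chartAt H b).source) :
    HasFDerivWithinAt (extChartAt I b ∘ (extChartAt I a).symm)
      (coords I b x ∘L coordFieldL I a x) (Set.range I) (extChartAt I a x) := by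
  have h := hasFDerivWithinAt_writtenInCharts (I := I) (f := fun x : M ↦ x) (x := x)
    mdifferentiableAt_id ha hb
  exact h.congr_fderiv (coords_mfderiv_id_coordFieldL a b x)

lemma contDiffWithinAt_transition {x a b : M} (ha : x ∈ (chartAt H a).source)
    (hb : x ∈ (chartAt H b).source) :
    ContDiffWithinAt ℝ ∞ (extChartAt I b ∘ (extChartAt I a).symm) (Set.range I)
      (extChartAt I a x) := by
  have ha' : x ∈ (extChartAt I a).source := by simpa using ha
  have h1 := contMDiffWithinAt_extChartAt_symm_range (I := I) (n := ∞) a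
    ((extChartAt I a).map_source ha')
  have h2 : ContMDiffAt I 𝓘(ℝ, EuclideanSpace ℝ (Fin d)) ∞ (extChartAt I b)
      ((extChartAt I a).symm (extChartAt I a x)) := by
    rw [(extChartAt I a).left_inv ha']
    exact contMDiffAt_extChartAt' hb
  exact contMDiffWithinAt_iff_contDiffWithinAt.1 (h2.comp_contMDiffWithinAt _ h1)

/-- The coordinates of a `C^1` vector field are `C^1` in every chart. -/
lemma contDiffOn_coords {W : ∀ x : M, TangentSpace I x}
    (hW : ContMDiff I I.tangent 1 (fun x ↦ (⟨x, W x⟩ : TangentBundle I M))) (q : M) :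
    ContDiffOn ℝ 1 (fun y ↦ coords I q ((extChartAt I q).symm y) (W ((extChartAt I q).symm y)))
      (extChartAt I q).target := by
  intro y hy
  have hy' : (extChartAt I q).symm y ∈ (chartAt H q).source := by
    simpa using (extChartAt I q).map_target hy
  have hb : (extChartAt I q).symm y ∈
      (trivializationAt (EuclideanSpace ℝ (Fin d)) (TangentSpace I) q).baseSet := by
    simpa using hy'
  have h1 := ((trivializationAt (EuclideanSpace ℝ (Fin d))
    (TangentSpace I) q).contMDiffAt_section_iff hb).1 (hW _)
  have h2 := h1.comp_contMDiffWithinAt y (contMDiffOn_extChartAt_symm (I := I) (n := 1) q y hy)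
  refine (contMDiffWithinAt_iff_contDiffWithinAt.1 h2).congr (fun z hz ↦ ?_) ?_
  · exact coords_apply (by simpa using (extChartAt I q).map_target hz) _
  · exact coords_apply hy' _

/-- A vector field is `C^1` if it is so in the preferred chart at every point. -/
lemma contMDiff_of_sectionCoord {W : ∀ x : M, TangentSpace I x}
    (hW : ∀ p, ContDiffWithinAt ℝ 1 (sectionCoord I (fun x : M ↦ x) W p) (Set.range I)
      (extChartAt I p p)) :
    ContMDiff I I.tangent 1 (fun x ↦ (⟨x, W x⟩ : TangentBundle I M)) := by
  intro p
  have h1 : ContMDiffAt I 𝓘(ℝ, EuclideanSpace ℝ (Fin d)) 1 (fun x ↦ coords I p x (W x)) p :=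
    contMDiffAt_iff.2 ⟨((mdifferentiableAt_iff_coord (I := I) (p := p)
      (h := fun x ↦ coords I p x (W x))).2
      ((hW p).differentiableWithinAt one_ne_zero)).continuousAt, hW p⟩
  refine (contMDiffAt_section p).2 (h1.congr_of_eventuallyEq ?_)
  filter_upwards [(chartAt H p).open_source.mem_nhds (mem_chart_source H p)] with x hx
  exact (coords_apply hx _).symm

variable [RiemannianBundle (fun x : M ↦ TangentSpace I x)]
  [IsContMDiffRiemannianBundle I ∞ (EuclideanSpace ℝ (Fin d)) (fun x : M ↦ TangentSpace I x)]

lemma contDiffOn_densityCoord {W : ∀ x : M, TangentSpace I x}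
    (hW : ContMDiff I I.tangent 1 (fun x ↦ (⟨x, W x⟩ : TangentBundle I M))) (q : M) :
    ContDiffOn ℝ 1 (densityCoord I W q) (extChartAt I q).target :=
  ((contDiffOn_density q).of_le (by simp)).smul (contDiffOn_coords hW q)

lemma differentiableWithinAt_densityCoord {W : ∀ x : M, TangentSpace I x}
    (hW : ContMDiff I I.tangent 1 (fun x ↦ (⟨x, W x⟩ : TangentBundle I M))) {q : M}
    {y : EuclideanSpace ℝ (Fin d)} (hy : y ∈ (extChartAt I q).target) :
    DifferentiableWithinAt ℝ (densityCoord I W q) (Set.range I) y :=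
  ((contDiffOn_densityCoord hW q y hy).mono_of_mem_nhdsWithin
    (extChartAt_target_mem_nhdsWithin_of_mem hy)).differentiableWithinAt one_ne_zero

/-- The divergence is the same in all charts. -/
theorem chartDiv_eq {W : ∀ x : M, TangentSpace I x}
    (hW : ContMDiff I I.tangent 1 (fun x ↦ (⟨x, W x⟩ : TangentBundle I M))) {q x : M}
    (hx : x ∈ (chartAt H q).source) : chartDiv I W q x = chartDiv I W x x := by
  have hxS := mem_chart_source H x
  have hx' : x ∈ (extChartAt I q).source := by simpa using hx
  set y₀ := extChartAt I x x with hy₀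
  have hy₀S : y₀ ∈ Set.range I := ⟨_, rfl⟩
  set ψ := extChartAt I q ∘ (extChartAt I x).symm with hψ
  have hψy : ψ y₀ = extChartAt I q x := by
    simp only [ψ, Function.comp_apply, hy₀, extChartAt_to_inv]
  have hψC : ContDiffWithinAt ℝ ∞ ψ (Set.range I) y₀ := contDiffWithinAt_transition hxS hx
  set A := fderivWithin ℝ ψ (Set.range I) with hA
  have hAC : ContDiffWithinAt ℝ 1 A (Set.range I) y₀ :=
    (hψC.of_le (WithTop.coe_le_coe.2 le_top : (2 : WithTop ℕ∞) ≤ ∞)).fderivWithin_right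
      I.uniqueDiffOn (by norm_num) hy₀S
  have hAeq {z : M} (hz : z ∈ (chartAt H x).source) (hzq : z ∈ (chartAt H q).source) :
      A (extChartAt I x z) = coords I q z ∘L coordFieldL I x z :=
    (hasFDerivWithinAt_transition hz hzq).fderivWithin (uniqueDiffWithinAt_coord x z)
  have hAequiv {z : M} (hz : z ∈ (chartAt H x).source) (hzq : z ∈ (chartAt H q).source) :
      A (extChartAt I x z) = ((coordsEquiv I x z hz).trans (coordsEquiv I q z hzq).symm :
        EuclideanSpace ℝ (Fin d) ≃L[ℝ] EuclideanSpace ℝ (Fin d)) :=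
    (hAeq hz hzq).trans rfl
  have hAinv : (A y₀).IsInvertible := ⟨_, (hAequiv hxS hx).symm⟩
  have hdetC : ContDiffWithinAt ℝ 1 (fun y ↦ (A y).det) (Set.range I) y₀ :=
    (contDiff_clm_det.contDiffAt).comp_contDiffWithinAt y₀ hAC
  have hdet₀ : (A y₀).det ≠ 0 := by
    obtain ⟨e, he⟩ := hAinv
    rw [← he]
    exact (LinearEquiv.isUnit_det' e.toLinearEquiv).ne_zero
  -- The determinant of the transition map keeps its sign near y₀, so |det A| in the law for
  -- densities may be replaced by s · det A.
  obtain ⟨s, hs, hsign⟩ : ∃ s : ℝ, s * s = 1 ∧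
      ∀ᶠ y in 𝓝[Set.range I] y₀, |(A y).det| = s * (A y).det := by
    rcases lt_or_gt_of_ne hdet₀ with h | h
    · refine ⟨-1, by norm_num, ?_⟩
      filter_upwards [hdetC.continuousWithinAt.eventually_lt_const h] with y hy
      rw [abs_of_neg hy]; ring
    · refine ⟨1, by norm_num, ?_⟩
      filter_upwards [hdetC.continuousWithinAt.eventually_const_lt h] with y hy
      rw [abs_of_pos hy]; ring
  -- Densities and coordinates transform together as a Piola transform along the transition map ψ,
  -- so no derivative of A survives in the divergence.
  have hloc : densityCoord I W x =ᶠ[𝓝[Set.range I] y₀]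
      fun y ↦ s • ((A y).det • (A y).inverse ((densityCoord I W q ∘ ψ) y)) := by
    have h1 := (chartAt H q).open_source.mem_nhds hx
    have h2 := (chartAt H x).open_source.mem_nhds hxS
    filter_upwards [hsign, eventually_nhdsWithin_extChartAt_symm hxS (Filter.Eventually.and h1 h2),
      extChartAt_target_mem_nhdsWithin (I := I) x] with y hy1 hy2 hyt
    have hyz := (extChartAt I x).right_inv hyt
    set z := (extChartAt I x).symm y with hz
    have hdens := density_eq_abs_det_mul (I := I) hy2.2 hy2.1
    have hinv : (A y).inverse (coords I q z (W z)) = coords I x z (W z) := by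
      rw [← hyz, hAequiv hy2.2 hy2.1, ContinuousLinearMap.inverse_equiv]
      refine (ContinuousLinearEquiv.symm_apply_eq _).2 ?_
      exact (congrArg (coords I q z) (coordFieldL_coords hy2.2 (W z))).symm
    rw [← hAeq hy2.2 hy2.1, hyz, hy1] at hdens
    have hψz : (densityCoord I W q ∘ ψ) y =
        density I q (extChartAt I q z) • coords I q z (W z) := by
      simp only [Function.comp_apply, ψ, densityCoord]
      have hzq : z ∈ (chartAt H q).source := hy2.1
      rw [← hz, (extChartAt I q).left_inv (by simpa using hzq)]
      rfl
    rw [hψz, map_smul, hinv, densityCoord, hdens, smul_smul, smul_smul, mul_assoc]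
  have hD := (differentiableWithinAt_densityCoord hW
    ((extChartAt I q).map_source hx')).hasFDerivWithinAt
  rw [← hψy] at hD
  set D := fderivWithin ℝ (densityCoord I W q) (Set.range I) (ψ y₀) with hDdef
  have hψd : HasFDerivWithinAt ψ (A y₀) (Set.range I) y₀ :=
    (hψC.differentiableWithinAt (by simp)).hasFDerivWithinAt
  have hv := hD.comp y₀ hψd (fun y _ ↦ ⟨_, rfl⟩)
  obtain ⟨V', hV', htr⟩ := hasFDerivWithinAt_det_smul_inverse I.uniqueDiffOn hy₀S
    (I.range_subset_closure_interior hy₀S)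
    (hψC.of_le (WithTop.coe_le_coe.2 le_top : (2 : WithTop ℕ∞) ≤ ∞)) hAinv hv
  have hV := (hV'.const_smul s).congr_of_eventuallyEq hloc (hloc.eq_of_nhdsWithin hy₀S)
  have htrD : LinearMap.trace ℝ _ ((A y₀).inverse ∘L D ∘L A y₀).toLinearMap =
      LinearMap.trace ℝ _ D.toLinearMap := by
    obtain ⟨e, he⟩ := hAinv
    rw [← he, ContinuousLinearMap.inverse_equiv]
    exact LinearMap.trace_conj' D.toLinearMap e.symm.toLinearEquiv
  have htr' : LinearMap.trace ℝ _ V'.toLinearMap =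
      (A y₀).det * LinearMap.trace ℝ _ D.toLinearMap := htr.trans (congrArg _ htrD)
  have hdens := density_eq_abs_det_mul (I := I) hxS hx
  rw [← hAeq hxS hx, ← hy₀, hsign.self_of_nhdsWithin hy₀S] at hdens
  rw [chartDiv, chartDiv, ← hy₀, hV.fderivWithin (uniqueDiffWithinAt_coord x x),
    ContinuousLinearMap.toLinearMap_smul, map_smul, htr', hdens, ← hψy, ← hDdef, smul_eq_mul]
  have hq : density I q (ψ y₀) ≠ 0 := by rw [hψy]; exact (density_pos hx).ne'
  have hs0 : s ≠ 0 := by rintro rfl; simp at hs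
  field_simp

end Divergence

/-! ### The Riemannian volume measure in charts -/

section Volume

set_option linter.unusedSectionVars false

lemma _root_.ContinuousOn.measurableSet_inter_preimage {α β : Type*} [TopologicalSpace α]
    [MeasurableSpace α] [OpensMeasurableSpace α] [TopologicalSpace β] [MeasurableSpace β]
    [BorelSpace β] {g : α → β} {t : Set α} (hg : ContinuousOn g t) (ht : MeasurableSet t)
    {B : Set β} (hB : MeasurableSet B) : MeasurableSet (g ⁻¹' B ∩ t) := by
  have h := ht.subtype_image (hg.domRestrict.measurable hB)
  convert h using 1
  ext y
  simp [Set.mem_image, and_comm]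

variable {d : ℕ} {H : Type*} [TopologicalSpace H]
  {I : ModelWithCorners ℝ (EuclideanSpace ℝ (Fin d)) H}
  {M : Type*} [TopologicalSpace M] [ChartedSpace H M]

lemma measurableSet_extChartAt_target (q : M) : MeasurableSet (extChartAt I q).target := by
  rw [extChartAt_target]
  exact ((chartAt H q).open_target.preimage I.continuous_symm).measurableSet.inter
    I.isClosed_range.measurableSet

variable [MeasurableSpace M] [BorelSpace M]

/-- `Measure.map` is zero for a map that is not a.e. measurable. The inverse chart is known to be
continuous only on its target, which is enough for the restricted measure. -/
lemma aemeasurable_extChartAt_symm (q : M) : AEMeasurable (extChartAt I q).symm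
    ((volume : Measure (EuclideanSpace ℝ (Fin d))).restrict (extChartAt I q).target) :=
  (continuousOn_extChartAt_symm q).aemeasurable (measurableSet_extChartAt_target q)

variable [IsManifold I ∞ M] [RiemannianBundle (fun x : M ↦ TangentSpace I x)]

lemma chartVolume_apply (q : M) {B : Set M} (hB : MeasurableSet B) :
    chartVolume I q B = ∫⁻ y in (extChartAt I q).symm ⁻¹' B ∩ (extChartAt I q).target,
      ENNReal.ofReal (density I q y) := by
  rw [chartVolume, Measure.map_apply_of_aemeasurable
    ((aemeasurable_extChartAt_symm q).mono_ac (withDensity_absolutelyContinuous _ _)) hB,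
    withDensity_apply', Measure.restrict_restrict' (measurableSet_extChartAt_target q)]
  rfl

lemma chartVolume_eq_zero {q : M} {B : Set M} (hB : MeasurableSet B)
    (h : Disjoint B (chartAt H q).source) : chartVolume I q B = 0 := by
  have : (extChartAt I q).symm ⁻¹' B ∩ (extChartAt I q).target = ∅ := by
    ext y
    simp only [Set.mem_inter_iff, Set.mem_preimage, Set.mem_empty_iff_false, iff_false, not_and]
    intro hy hy'
    exact Set.disjoint_left.1 h hy (by simpa using (extChartAt I q).map_target hy')
  rw [chartVolume_apply q hB, this]
  simp

variable [IsContMDiffRiemannianBundle I ∞ (EuclideanSpace ℝ (Fin d))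
  (fun x : M ↦ TangentSpace I x)]

/-- The local volume measures agree on overlaps of charts. -/
lemma chartVolume_eq_of_subset {q r : M} {B : Set M} (hB : MeasurableSet B)
    (hq : B ⊆ (chartAt H q).source) (hr : B ⊆ (chartAt H r).source) :
    chartVolume I q B = chartVolume I r B := by
  rw [chartVolume_apply q hB, chartVolume_apply r hB]
  set s := (extChartAt I q).symm ⁻¹' B ∩ (extChartAt I q).target with hs
  have hsm : MeasurableSet s :=
    (continuousOn_extChartAt_symm q).measurableSet_inter_preimage
      (measurableSet_extChartAt_target q) hB
  set ψ := extChartAt I r ∘ (extChartAt I q).symm with hψ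
  have hsr {y} (hy : y ∈ s) : (extChartAt I q).symm y ∈ (extChartAt I r).source := by
    simpa using hr hy.1
  have himage : ψ '' s = (extChartAt I r).symm ⁻¹' B ∩ (extChartAt I r).target := by
    ext z
    constructor
    · rintro ⟨y, hy, rfl⟩
      refine ⟨?_, (extChartAt I r).map_source (hsr hy)⟩
      simp only [Set.mem_preimage, ψ, Function.comp_apply]
      rw [(extChartAt I r).left_inv (hsr hy)]
      exact hy.1
    · rintro ⟨hz, hz'⟩
      have hzq : (extChartAt I r).symm z ∈ (extChartAt I q).source := by simpa using hq hz
      refine ⟨extChartAt I q ((extChartAt I r).symm z), ⟨?_, (extChartAt I q).map_source hzq⟩, ?_⟩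
      · simp only [Set.mem_preimage]
        rw [(extChartAt I q).left_inv hzq]
        exact hz
      · simp only [ψ, Function.comp_apply]
        rw [(extChartAt I q).left_inv hzq, (extChartAt I r).right_inv hz']
  have hinj : Set.InjOn ψ s := by
    intro y hy z hz h
    exact (extChartAt I q).symm.injOn hy.2 hz.2 ((extChartAt I r).injOn (hsr hy) (hsr hz) h)
  have hderiv : ∀ y ∈ s, HasFDerivWithinAt ψ (coords I r ((extChartAt I q).symm y) ∘L
      coordFieldL I q ((extChartAt I q).symm y)) s y := by
    intro y hy
    have h := hasFDerivWithinAt_transition (I := I) (hq hy.1) (hr hy.1)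
    rw [(extChartAt I q).right_inv hy.2] at h
    exact h.mono fun z hz ↦ extChartAt_target_subset_range q hz.2
  -- Change of variables: the Jacobian |det Dψ| is the factor in the transformation law of the
  -- densities.
  rw [← himage, lintegral_image_eq_lintegral_abs_det_fderiv_mul _ hsm hderiv hinj]
  refine setLIntegral_congr_fun hsm fun y hy ↦ ?_
  have h := density_eq_abs_det_mul (I := I) (hq hy.1) (hr hy.1)
  rw [(extChartAt I q).right_inv hy.2] at h
  simp only
  rw [h, ENNReal.ofReal_mul (abs_nonneg _)]
  rfl

variable [T2Space M]

/-- Identifying the supremum of the chart measures on one chart domain needs a common upper bound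
that is sharp there. Off the domain, infinity times counting measure dominates everything. -/
lemma chartVolume_le (q r : M) : chartVolume I r ≤
    chartVolume I q + ((⊤ : ENNReal) • Measure.count).restrict (chartAt H q).sourceᶜ := by
  have hq : MeasurableSet (chartAt H q).source := (chartAt H q).open_source.measurableSet
  have hr : MeasurableSet (chartAt H r).source := (chartAt H r).open_source.measurableSet
  refine Measure.le_iff.2 fun B hB ↦ ?_
  rw [← measure_inter_add_sdiff B hq, Measure.add_apply]
  refine add_le_add ?_ ?_
  · rw [← measure_inter_add_sdiff (B ∩ _) hr,
      chartVolume_eq_zero (q := r) ((hB.inter hq).diff hr) Set.disjoint_sdiff_left, add_zero,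
      ← chartVolume_eq_of_subset (q := q) ((hB.inter hq).inter hr)
        (fun x hx ↦ hx.1.2) (fun x hx ↦ hx.2)]
    exact measure_mono fun x hx ↦ hx.1.1
  · rw [Measure.restrict_apply hB, ← Set.sdiff_eq]
    rcases (B \ (chartAt H q).source).eq_empty_or_nonempty with h | h
    · simp [h]
    · rw [Measure.smul_apply, smul_eq_mul, ENNReal.top_mul]
      · exact le_top
      · exact Measure.count_ne_zero h

/-- In the domain of a chart, the Riemannian volume is `√(det g) dy`. -/
theorem riemannianVolume_restrict (q : M) :
    (riemannianVolume I M).restrict (chartAt H q).source = chartVolume I q := by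
  have hq : MeasurableSet (chartAt H q).source := (chartAt H q).open_source.measurableSet
  refine Measure.ext fun B hB ↦ ?_
  have h0 : chartVolume I q B = chartVolume I q (B ∩ (chartAt H q).source) := by
    rw [← measure_inter_add_sdiff B hq,
      chartVolume_eq_zero (q := q) (hB.diff hq) Set.disjoint_sdiff_left, add_zero]
  rw [Measure.restrict_apply hB, h0]
  refine le_antisymm ?_ (Measure.le_iff.1 (le_iSup (chartVolume I) q) _ (hB.inter hq))
  refine (Measure.le_iff.1 (iSup_le (chartVolume_le (I := I) q)) _ (hB.inter hq)).trans ?_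
  rw [Measure.add_apply, Measure.restrict_apply (hB.inter hq), Set.inter_assoc,
    Set.inter_compl_self, Set.inter_empty, measure_empty, add_zero]

/-- Integrals of functions that vanish outside the domain of a chart, in the chart. -/
theorem integrable_and_integral_eq_of_chart (q : M) {u : M → ℝ}
    (hu : ContinuousOn u (chartAt H q).source) (hu0 : ∀ x ∉ (chartAt H q).source, u x = 0)
    (hint : IntegrableOn (fun y ↦ density I q y * u ((extChartAt I q).symm y))
      (extChartAt I q).target) :
    Integrable u (riemannianVolume I M) ∧ ∫ x, u x ∂(riemannianVolume I M) =
      ∫ y in (extChartAt I q).target, density I q y * u ((extChartAt I q).symm y) := by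
  have hq : MeasurableSet (chartAt H q).source := (chartAt H q).open_source.measurableSet
  have hm : AEMeasurable (extChartAt I q).symm
      (((volume : Measure (EuclideanSpace ℝ (Fin d))).restrict (extChartAt I q).target).withDensity
        fun y ↦ ENNReal.ofReal (Real.sqrt (gramMatrix I q y).det)) :=
    (aemeasurable_extChartAt_symm q).mono_ac (withDensity_absolutelyContinuous _ _)
  have hum := hu.aestronglyMeasurable (μ := riemannianVolume I M) hq
  rw [riemannianVolume_restrict, chartVolume] at hum
  have hdm : AEMeasurable (fun y ↦ ENNReal.ofReal (Real.sqrt (gramMatrix I q y).det))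
      ((volume : Measure (EuclideanSpace ℝ (Fin d))).restrict (extChartAt I q).target) :=
    ((contDiffOn_density q).continuousOn.aemeasurable
      (measurableSet_extChartAt_target q)).ennreal_ofReal
  have htop : ∀ᵐ y ∂((volume : Measure (EuclideanSpace ℝ (Fin d))).restrict
      (extChartAt I q).target), ENNReal.ofReal (Real.sqrt (gramMatrix I q y).det) < ⊤ := by
    simp
  have hreal (y) : (ENNReal.ofReal (Real.sqrt (gramMatrix I q y).det)).toReal •
      (u ∘ (extChartAt I q).symm) y = density I q y * u ((extChartAt I q).symm y) := by
    rw [ENNReal.toReal_ofReal (Real.sqrt_nonneg _)]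
    rfl
  have hon : IntegrableOn u (chartAt H q).source (riemannianVolume I M) := by
    rw [IntegrableOn, riemannianVolume_restrict, chartVolume, integrable_map_measure hum hm,
      integrable_withDensity_iff_integrable_smul₀' hdm htop]
    simp_rw [hreal]
    exact hint
  refine ⟨(integrableOn_iff_integrable_of_support_subset fun x hx ↦ ?_).1 hon, ?_⟩
  · by_contra h
    exact hx (hu0 x h)
  · rw [← setIntegral_eq_integral_of_forall_compl_eq_zero hu0, riemannianVolume_restrict,
      chartVolume, integral_map hm hum, integral_withDensity_eq_integral_toReal_smul₀ hdm htop]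
    exact integral_congr_ae (.of_forall hreal)

end Volume

/-! ### The divergence theorem -/

section DivergenceTheorem

set_option linter.unusedSectionVars false

lemma integrable_trace_fderiv {d : ℕ}
    {V : EuclideanSpace ℝ (Fin d) → EuclideanSpace ℝ (Fin d)} (hV : ContDiff ℝ 1 V)
    (hc : HasCompactSupport V) : Integrable (fun y ↦
      LinearMap.trace ℝ (EuclideanSpace ℝ (Fin d)) (fderiv ℝ V y).toLinearMap) := by
  have hcont : Continuous (fderiv ℝ V) := hV.continuous_fderiv one_ne_zero
  simp_rw [LinearMap.trace_eq_sum_inner _ (EuclideanSpace.basisFun (Fin d) ℝ)]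
  refine integrable_finsetSum _ fun i _ ↦ Continuous.integrable_of_hasCompactSupport ?_ ?_
  · exact continuous_const.inner (hcont.clm_apply continuous_const)
  · refine (hc.fderiv (𝕜 := ℝ)).mono fun y hy h ↦ hy ?_
    simp [h]

/-- The integral of the divergence of a compactly supported `C^1` vector field vanishes. -/
lemma integral_trace_fderiv {d : ℕ}
    {V : EuclideanSpace ℝ (Fin d) → EuclideanSpace ℝ (Fin d)} (hV : ContDiff ℝ 1 V)
    (hc : HasCompactSupport V) :
    ∫ y, LinearMap.trace ℝ (EuclideanSpace ℝ (Fin d)) (fderiv ℝ V y).toLinearMap = 0 := by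
  have hcont : Continuous (fderiv ℝ V) := hV.continuous_fderiv one_ne_zero
  have hint (i : Fin d) : Integrable (fun y ↦ inner ℝ (EuclideanSpace.basisFun (Fin d) ℝ i)
      (fderiv ℝ V y (EuclideanSpace.basisFun (Fin d) ℝ i))) := by
    refine Continuous.integrable_of_hasCompactSupport ?_ ?_
    · exact continuous_const.inner (hcont.clm_apply continuous_const)
    · refine (hc.fderiv (𝕜 := ℝ)).mono fun y hy h ↦ hy ?_
      simp [h]
  simp_rw [LinearMap.trace_eq_sum_inner _ (EuclideanSpace.basisFun (Fin d) ℝ)]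
  refine (integral_finsetSum _ fun i _ ↦ hint i).trans ?_
  refine Finset.sum_eq_zero fun i _ ↦ ?_
  set e := EuclideanSpace.basisFun (Fin d) ℝ i
  set g : EuclideanSpace ℝ (Fin d) → ℝ := fun y ↦ inner ℝ e (V y)
  have hg' (y) : fderiv ℝ g y e = inner ℝ e (fderiv ℝ V y e) := by
    have h := (innerSL ℝ e).hasFDerivAt.comp y
      (hV.differentiable one_ne_zero y).hasFDerivAt
    exact congrArg (· e) h.fderiv
  have hgd : Differentiable ℝ g :=
    (innerSL ℝ e).differentiable.comp (hV.differentiable one_ne_zero)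
  have hgint : Integrable g :=
    (continuous_const.inner hV.continuous).integrable_of_hasCompactSupport
      (hc.mono fun y hy h ↦ hy (by simp [g, h]))
  -- Integration by parts against the constant function 1.
  have h := integral_mul_fderiv_eq_neg_fderiv_mul_of_integrable (𝕜 := ℝ) (μ := volume)
    (f := fun _ ↦ (1 : ℝ)) (g := g) (v := e) (by simp) (by simp_rw [hg', one_mul]; exact hint i)
    (by simpa using hgint) (fun _ _ ↦ differentiableAt_const _) (fun y _ ↦ hgd y)
  simpa [hg'] using h

variable {d : ℕ} {H : Type*} [TopologicalSpace H]
  {I : ModelWithCorners ℝ (EuclideanSpace ℝ (Fin d)) H}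
  {M : Type*} [TopologicalSpace M] [ChartedSpace H M] [IsManifold I ∞ M]
  [RiemannianBundle (fun x : M ↦ TangentSpace I x)]

lemma densityCoord_eventuallyEq_zero {W : ∀ x : M, TangentSpace I x} {K : Set M}
    (hK : IsClosed K) (hW0 : ∀ x ∉ K, W x = 0) {q x : M} (hq : x ∈ (chartAt H q).source)
    (hx : x ∉ K) :
    densityCoord I W q =ᶠ[𝓝[Set.range I] (extChartAt I q x)] fun _ ↦ 0 := by
  filter_upwards [eventually_nhdsWithin_extChartAt_symm hq (hK.isOpen_compl.mem_nhds hx)]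
    with y hy
  rw [densityCoord, hW0 _ hy, map_zero, smul_zero]

lemma chartDiv_eq_zero {W : ∀ x : M, TangentSpace I x} {K : Set M}
    (hK : IsClosed K) (hW0 : ∀ x ∉ K, W x = 0) {q x : M} (hq : x ∈ (chartAt H q).source)
    (hx : x ∉ K) : chartDiv I W q x = 0 := by
  rw [chartDiv, (densityCoord_eventuallyEq_zero hK hW0 hq hx).fderivWithin_eq_of_mem ⟨_, rfl⟩,
    fderivWithin_fun_const]
  simp

variable [IsContMDiffRiemannianBundle I ∞ (EuclideanSpace ℝ (Fin d))
  (fun x : M ↦ TangentSpace I x)]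

/-- The chart is fixed here, because in x ↦ `chartDiv I W x x` it changes with the point.
`chartDiv_eq` carries the continuity over. -/
lemma continuousOn_chartDiv {W : ∀ x : M, TangentSpace I x}
    (hW : ContMDiff I I.tangent 1 (fun x ↦ (⟨x, W x⟩ : TangentBundle I M))) (q : M) :
    ContinuousOn (chartDiv I W q) (chartAt H q).source := by
  intro x hx
  have hx' : x ∈ (extChartAt I q).source := by simpa using hx
  have hy := (extChartAt I q).map_source hx'
  have hφ : Filter.Tendsto (extChartAt I q) (𝓝 x) (𝓝[Set.range I] (extChartAt I q x)) :=
    tendsto_nhdsWithin_iff.2 ⟨(continuousAt_extChartAt' hx').tendsto, .of_forall fun z ↦ ⟨_, rfl⟩⟩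
  have hC : ContDiffWithinAt ℝ 1 (densityCoord I W q) (Set.range I) (extChartAt I q x) :=
    (contDiffOn_densityCoord hW q _ hy).mono_of_mem_nhdsWithin
      (extChartAt_target_mem_nhdsWithin_of_mem hy)
  have h1 : ContinuousWithinAt (fderivWithin ℝ (densityCoord I W q) (Set.range I)) (Set.range I)
      (extChartAt I q x) :=
    (hC.fderivWithin_right (m := 0) I.uniqueDiffOn (by simp) ⟨_, rfl⟩).continuousWithinAt
  have h2 : Continuous fun A : EuclideanSpace ℝ (Fin d) →L[ℝ] EuclideanSpace ℝ (Fin d) ↦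
      LinearMap.trace ℝ (EuclideanSpace ℝ (Fin d)) A.toLinearMap := by
    simp_rw [LinearMap.trace_eq_sum_inner _ (EuclideanSpace.basisFun (Fin d) ℝ)]
    refine continuous_finsetSum _ fun i _ ↦ continuous_const.inner ?_
    exact continuous_id.clm_apply continuous_const
  have h3 : ContinuousWithinAt (fun y ↦ (density I q y)⁻¹) (Set.range I) (extChartAt I q x) :=
    (contDiffWithinAt_density hy).continuousWithinAt.inv₀ (density_pos hx).ne'
  exact ((h3.tendsto.mul ((h2.tendsto _).comp h1.tendsto)).comp hφ).mono_left nhdsWithin_le_nhds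

/-- An interior point is recognized in any chart of the atlas, not only in the preferred one. This
keeps supports away from the boundary of the chart's image. -/
lemma extChartAt_mem_interior_target {q x : M} (hq : x ∈ (chartAt H q).source)
    (hx : x ∈ I.interior M) : extChartAt I q x ∈ interior (extChartAt I q).target :=
  (I.isInteriorPoint_iff_of_mem_atlas (n := ∞) (by simp) (chart_mem_atlas H q) hq).1 hx

lemma chartDiv_sum {ι : Type*} (s : Finset ι) {W : ι → ∀ x : M, TangentSpace I x}
    (hW : ∀ i ∈ s, ContMDiff I I.tangent 1 (fun x ↦ (⟨x, W i x⟩ : TangentBundle I M))) (x : M) :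
    chartDiv I (fun z ↦ ∑ i ∈ s, W i z) x x = ∑ i ∈ s, chartDiv I (W i) x x := by
  have h1 : densityCoord I (fun z ↦ ∑ i ∈ s, W i z) x =
      fun y ↦ ∑ i ∈ s, densityCoord I (W i) x y := by
    ext1 y
    simp only [densityCoord]
    rw [map_sum, Finset.smul_sum]
  simp only [chartDiv]
  rw [h1, fderivWithin_fun_sum (uniqueDiffWithinAt_coord x x) fun i hi ↦
    differentiableWithinAt_densityCoord (hW i hi) (mem_extChartAt_target x), ← Finset.mul_sum,
    ← map_sum]
  congr 2
  ext
  simp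

variable [T2Space M] [MeasurableSpace M] [BorelSpace M]

/-- The divergence theorem for a vector field supported in the domain of a chart. -/
lemma integral_chartDiv_of_subset_source {W : ∀ x : M, TangentSpace I x}
    (hW : ContMDiff I I.tangent 1 (fun x ↦ (⟨x, W x⟩ : TangentBundle I M))) {K : Set M}
    (hK : IsCompact K) (hKI : K ⊆ I.interior M) (hW0 : ∀ x ∉ K, W x = 0) {q : M}
    (hKq : K ⊆ (chartAt H q).source) :
    Integrable (fun x ↦ chartDiv I W x x) (riemannianVolume I M) ∧
      ∫ x, chartDiv I W x x ∂(riemannianVolume I M) = 0 := by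
  classical
  set T := (extChartAt I q).target with hT
  set C := extChartAt I q '' K with hC
  have hKq' : K ⊆ (extChartAt I q).source := by simpa using hKq
  have hCc : IsCompact C := hK.image_of_continuousOn ((continuousOn_extChartAt q).mono hKq')
  have hCT : C ⊆ interior T := by
    rintro _ ⟨x, hx, rfl⟩
    exact extChartAt_mem_interior_target (hKq hx) (hKI hx)
  have hsource {y} (hy : y ∈ T) : (extChartAt I q).symm y ∈ (chartAt H q).source := by
    simpa using (extChartAt I q).map_target hy
  have hnot {y} (hy : y ∈ T) (hyC : y ∉ C) : (extChartAt I q).symm y ∉ K := fun h ↦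
    hyC ⟨_, h, (extChartAt I q).right_inv hy⟩
  -- Off the target the coordinate expression has no meaning, so it is cut off to C. As C is compact
  -- in the interior of the target and W vanishes off K, V is C¹ on the whole space.
  set V := C.indicator (densityCoord I W q) with hV
  have hVT {y} (hy : y ∈ T) : V y = densityCoord I W q y := by
    by_cases hyC : y ∈ C
    · exact Set.indicator_of_mem hyC _
    · rw [hV, Set.indicator_of_notMem hyC, densityCoord, hW0 _ (hnot hy hyC), map_zero, smul_zero]
  have hV_in {y} (hy : y ∈ C) : V =ᶠ[𝓝 y] densityCoord I W q := by
    filter_upwards [isOpen_interior.mem_nhds (hCT hy)] with z hz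
    exact hVT (interior_subset hz)
  have hV_out {y} (hy : y ∉ C) : V =ᶠ[𝓝 y] fun _ ↦ 0 := by
    filter_upwards [hCc.isClosed.isOpen_compl.mem_nhds hy] with z hz
    exact Set.indicator_of_notMem hz _
  have hVC : ContDiff ℝ 1 V := by
    refine contDiff_iff_contDiffAt.2 fun y ↦ ?_
    by_cases hy : y ∈ C
    · exact ((contDiffOn_densityCoord hW q).contDiffAt
        (mem_interior_iff_mem_nhds.1 (hCT hy))).congr_of_eventuallyEq (hV_in hy)
    · exact contDiffAt_const.congr_of_eventuallyEq (hV_out hy)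
  have hVc : HasCompactSupport V :=
    HasCompactSupport.intro hCc fun y hy ↦ Set.indicator_of_notMem hy _
  have htrace {y} (hy : y ∈ T) : density I q y *
      chartDiv I W ((extChartAt I q).symm y) ((extChartAt I q).symm y) =
      LinearMap.trace ℝ (EuclideanSpace ℝ (Fin d)) (fderiv ℝ V y).toLinearMap := by
    have hfd : fderivWithin ℝ (densityCoord I W q) (Set.range I) y = fderiv ℝ V y := by
      by_cases hyC : y ∈ C
      · rw [(hV_in hyC).fderiv_eq, fderivWithin_of_mem_nhds]
        exact Filter.mem_of_superset (mem_interior_iff_mem_nhds.1 (hCT hyC))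
          (extChartAt_target_subset_range q)
      · have h := densityCoord_eventuallyEq_zero (I := I) hK.isClosed hW0 (hsource hy)
          (hnot hy hyC)
        rw [(extChartAt I q).right_inv hy] at h
        rw [h.fderivWithin_eq_of_mem (extChartAt_target_subset_range q hy),
          (hV_out hyC).fderiv_eq, fderivWithin_fun_const, fderiv_fun_const]
    rw [← chartDiv_eq hW (hsource hy), chartDiv, (extChartAt I q).right_inv hy,
      mul_inv_cancel_left₀ (density_pos' hy).ne', hfd]
  have hTm : MeasurableSet T := measurableSet_extChartAt_target q
  have h := integrable_and_integral_eq_of_chart (I := I) q (u := fun x ↦ chartDiv I W x x)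
    ((continuousOn_chartDiv hW q).congr fun x hx ↦ (chartDiv_eq hW hx).symm)
    (fun x hx ↦ chartDiv_eq_zero hK.isClosed hW0 (mem_chart_source H x) fun hxK ↦ hx (hKq hxK))
    (((integrable_trace_fderiv hVC hVc).integrableOn).congr_fun (fun y hy ↦ (htrace hy).symm) hTm)
  refine ⟨h.1, h.2.trans ?_⟩
  rw [setIntegral_congr_fun hTm fun y hy ↦ htrace hy,
    setIntegral_eq_integral_of_forall_compl_eq_zero, integral_trace_fderiv hVC hVc]
  intro y hy
  rw [(hV_out fun hyC ↦ hy (interior_subset (hCT hyC))).fderiv_eq, fderiv_fun_const]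
  simp

/-- The divergence theorem for a vector field with compact support in the interior. -/
theorem integral_chartDiv [SecondCountableTopology M] {W : ∀ x : M, TangentSpace I x}
    (hW : ContMDiff I I.tangent 1 (fun x ↦ (⟨x, W x⟩ : TangentBundle I M))) {K : Set M}
    (hK : IsCompact K) (hKI : K ⊆ I.interior M) (hW0 : ∀ x ∉ K, W x = 0) :
    Integrable (fun x ↦ chartDiv I W x x) (riemannianVolume I M) ∧
      ∫ x, chartDiv I W x x ∂(riemannianVolume I M) = 0 := by
  have : LocallyCompactSpace M := Manifold.locallyCompact_of_finiteDimensional I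
  obtain ⟨ρ, hρ⟩ :=
    SmoothPartitionOfUnity.exists_isSubordinate_chartAt_source_of_isClosed I hK.isClosed
  have hfin := ρ.locallyFinite.finite_nonempty_inter_compact hK
  set s := hfin.toFinset with hs
  -- Only finitely many members of the partition meet K, and they sum to 1 there.
  have hWρ : W = fun x ↦ ∑ i ∈ s, ρ i x • W x := by
    ext1 x
    by_cases hx : x ∈ K
    · rw [← Finset.sum_smul]
      have h1 := ρ.sum_eq_one hx
      rw [finsum_eq_sum_of_support_subset (s := s) _ fun i hi ↦ ?_] at h1
      · rw [h1, one_smul]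
      · simp only [hs, Set.Finite.coe_toFinset, Set.mem_ofPred_eq]
        exact ⟨x, hi, hx⟩
    · simp [hW0 x hx]
  have hWC (i : K) : ContMDiff I I.tangent 1
      (fun x ↦ (⟨x, ρ i x • W x⟩ : TangentBundle I M)) :=
    ((ρ i).contMDiff.of_le (by simp)).smul_section hW
  have hloc (i : K) := integral_chartDiv_of_subset_source (hWC i) (K := K ∩ tsupport (ρ i))
    (hK.inter_right (isClosed_tsupport _)) (fun x hx ↦ hKI hx.1) (fun x hx ↦ by
      by_cases hxK : x ∈ K
      · rw [image_eq_zero_of_notMem_tsupport fun h ↦ hx ⟨hxK, h⟩, zero_smul]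
      · rw [hW0 x hxK, smul_zero]) (q := i) (fun x hx ↦ hρ i hx.2)
  rw [hWρ]
  simp_rw [chartDiv_sum s fun i _ ↦ hWC i]
  refine ⟨integrable_finsetSum _ fun i _ ↦ (hloc i).1, ?_⟩
  rw [integral_finsetSum _ fun i _ ↦ (hloc i).1]
  exact Finset.sum_eq_zero fun i _ ↦ (hloc i).2

end DivergenceTheorem

/-! ### The weak form of the Piola identity -/

section Weak

set_option linter.unusedSectionVars false

lemma innerHom_comm {V W : Type*} [NormedAddCommGroup V] [InnerProductSpace ℝ V]
    [FiniteDimensional ℝ V] [NormedAddCommGroup W] [InnerProductSpace ℝ W] (A B : V → W) :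
    innerHom A B = innerHom B A :=
  Finset.sum_congr rfl fun _ _ ↦ real_inner_comm _ _

variable {d : ℕ} {H : Type*} [TopologicalSpace H]
  {I : ModelWithCorners ℝ (EuclideanSpace ℝ (Fin d)) H}
  {M : Type*} [TopologicalSpace M] [ChartedSpace H M] [IsManifold I ∞ M]

/-- Test sections see only the interior. Through this density a continuous section is also
determined on the boundary. -/
lemma dense_interior : Dense (I.interior M) := by
  intro x
  have hx := I.range_subset_closure_interior (show extChartAt I x x ∈ Set.range I from ⟨_, rfl⟩)
  have hx' : x ∈ (extChartAt I x).source := mem_extChartAt_source x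
  refine mem_closure_iff_nhds.2 fun U hU ↦ ?_
  have h1 : (extChartAt I x).symm ⁻¹' U ∈ 𝓝 (extChartAt I x x) :=
    (continuousAt_extChartAt_symm (I := I) x).preimage_mem_nhds (by rwa [extChartAt_to_inv])
  have h2 : (extChartAt I x).target ∈ 𝓝[Set.range I] (extChartAt I x x) :=
    extChartAt_target_mem_nhdsWithin x
  obtain ⟨O, hO, hxO, hOT⟩ := mem_nhdsWithin.1 h2
  obtain ⟨y, ⟨hyU, hyO⟩, hyI⟩ := mem_closure_iff_nhds.1 hx _
    (Filter.inter_mem h1 (hO.mem_nhds hxO))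
  have hyT : y ∈ (extChartAt I x).target := hOT ⟨hyO, interior_subset hyI⟩
  have hys : (extChartAt I x).symm y ∈ (chartAt H x).source := by
    simpa using (extChartAt I x).map_target hyT
  refine ⟨_, hyU, (I.isInteriorPoint_iff_of_mem_atlas (n := ∞) (by simp)
    (chart_mem_atlas H x) hys).2 ?_⟩
  have hyT' : O ∩ interior (Set.range I) ⊆ (extChartAt I x).target := fun z hz ↦
    hOT ⟨hz.1, interior_subset hz.2⟩
  have := interior_maximal hyT' (hO.inter isOpen_interior) ⟨hyO, hyI⟩
  change extChartAt I x ((extChartAt I x).symm y) ∈ interior (extChartAt I x).target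
  rwa [(extChartAt I x).right_inv hyT]

section Positive

variable [RiemannianBundle (fun x : M ↦ TangentSpace I x)]
  [IsContMDiffRiemannianBundle I ∞ (EuclideanSpace ℝ (Fin d)) (fun x : M ↦ TangentSpace I x)]
  [T2Space M] [MeasurableSpace M] [BorelSpace M]

/-- In the chart the integrand is nonnegative, and it is positive on a neighbourhood of the image of
q. That neighbourhood has positive Lebesgue measure because q is an interior point. -/
lemma integral_pos_of_chart {u : M → ℝ} (hu : Continuous u) (hu0 : ∀ x, 0 ≤ u x) {q : M}
    (hq : q ∈ I.interior M) (hpos : 0 < u q) {K : Set M} (hK : IsCompact K)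
    (hKq : K ⊆ (chartAt H q).source) (huK : ∀ x ∉ K, u x = 0) :
    0 < ∫ x, u x ∂(riemannianVolume I M) := by
  set T := (extChartAt I q).target with hT
  set C := extChartAt I q '' K with hC
  have hKq' : K ⊆ (extChartAt I q).source := by simpa using hKq
  have hCc : IsCompact C := hK.image_of_continuousOn ((continuousOn_extChartAt q).mono hKq')
  have hCT : C ⊆ T := by
    rintro _ ⟨x, hx, rfl⟩
    exact (extChartAt I q).map_source (hKq' hx)
  have hTm : MeasurableSet T := measurableSet_extChartAt_target q
  have hcont : ContinuousOn (fun y ↦ density I q y * u ((extChartAt I q).symm y)) T :=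
    (contDiffOn_density q).continuousOn.mul
      (hu.comp_continuousOn (continuousOn_extChartAt_symm q))
  have hint : IntegrableOn (fun y ↦ density I q y * u ((extChartAt I q).symm y)) T := by
    refine ((hcont.mono hCT).integrableOn_compact hCc).of_forall_sdiff_eq_zero hTm fun y hy ↦ ?_
    rw [huK _ fun h ↦ hy.2 ⟨_, h, (extChartAt I q).right_inv hy.1⟩, mul_zero]
  rw [(integrable_and_integral_eq_of_chart (I := I) q hu.continuousOn
    (fun x hx ↦ huK x fun h ↦ hx (hKq h)) hint).2]
  have hTq : T ∈ 𝓝 (extChartAt I q q) :=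
    mem_interior_iff_mem_nhds.1 (extChartAt_mem_interior_target (mem_chart_source H q) hq)
  rw [setIntegral_pos_iff_support_of_nonneg_ae _ hint]
  · refine Measure.measure_pos_of_mem_nhds _ (x := extChartAt I q q) (Filter.inter_mem ?_ hTq)
    have h0 : 0 < density I q (extChartAt I q q) *
        u ((extChartAt I q).symm (extChartAt I q q)) := by
      rw [extChartAt_to_inv]
      exact mul_pos (density_pos (mem_chart_source H q)) hpos
    filter_upwards [(hcont.continuousAt hTq).eventually_const_lt h0] with y hy
    exact hy.ne'
  · refine (ae_restrict_iff' hTm).2 (.of_forall fun y hy ↦ ?_)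
    exact mul_nonneg (density_pos' hy).le (hu0 _)

end Positive

variable {M₁ : Type*} [TopologicalSpace M₁] [ChartedSpace H M₁] [IsManifold I ∞ M₁]
  {M₂ : Type*} [TopologicalSpace M₂] [ChartedSpace H M₂] [IsManifold I ∞ M₂] {f : M₁ → M₂}

lemma contMDiffAt_along_iff (hf : ContMDiff I I 1 f) {ξ : ∀ x, TangentSpace I (f x)} {p : M₁} :
    ContMDiffAt I I.tangent 1 (fun x ↦ (⟨f x, ξ x⟩ : TangentBundle I M₂)) p ↔
      ContMDiffAt I 𝓘(ℝ, EuclideanSpace ℝ (Fin d)) 1 (fun x ↦ coords I (f p) (f x) (ξ x)) p := by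
  have heq : (fun x ↦ coords I (f p) (f x) (ξ x)) =ᶠ[𝓝 p]
      fun x ↦ (trivializationAt (EuclideanSpace ℝ (Fin d)) (TangentSpace I) (f p)
        (⟨f x, ξ x⟩ : TangentBundle I M₂)).2 := by
    filter_upwards [hf.continuous.continuousAt.preimage_mem_nhds
      ((chartAt H (f p)).open_source.mem_nhds (mem_chart_source H (f p)))] with x hx
    exact coords_apply hx _
  rw [heq.contMDiffAt_iff]
  exact contMDiffAt_totalSpace.trans ⟨fun h ↦ h.2, fun h ↦ ⟨hf p, h⟩⟩

lemma contDiffWithinAt_sectionCoord (hf : ContMDiff I I 1 f) {ξ : ∀ x, TangentSpace I (f x)}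
    (hξ : ContMDiff I I.tangent 1 (fun x ↦ (⟨f x, ξ x⟩ : TangentBundle I M₂))) (p : M₁) :
    ContDiffWithinAt ℝ 1 (sectionCoord I f ξ p) (Set.range I) (extChartAt I p p) :=
  (contMDiffAt_iff.1 ((contMDiffAt_along_iff hf).1 (hξ p))).2

/-- A bump function times a coordinate field along `f` is a `C^1` section along `f`. -/
lemma contMDiff_bump_smul_coordField [T2Space M₁] (hf : ContMDiff I I 1 f) {q : M₁}
    (b : SmoothBumpFunction I q) (hb : ∀ x ∈ tsupport b, f x ∈ (chartAt H (f q)).source)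
    (u : EuclideanSpace ℝ (Fin d)) :
    ContMDiff I I.tangent 1
      (fun x ↦ (⟨f x, b x • coordField I (f q) u (f x)⟩ : TangentBundle I M₂)) := by
  intro p
  refine (contMDiffAt_along_iff hf).2 ?_
  by_cases hp : p ∈ tsupport b
  · have h1 : ContMDiffAt I I.tangent 1
        (fun x ↦ (⟨f x, coordField I (f q) u (f x)⟩ : TangentBundle I M₂)) p :=
      ((contMDiffAt_coordField (hb p hp) u).of_le (by simp)).comp p (hf p)
    have hb1 : ContMDiffAt I 𝓘(ℝ, ℝ) 1 b p := b.contMDiffAt.of_le (by simp)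
    have h2 := hb1.smul ((contMDiffAt_along_iff hf).1 h1)
    refine h2.congr_of_eventuallyEq (.of_forall fun x ↦ ?_)
    exact map_smul _ _ _
  · refine (contMDiffAt_const (c := 0)).congr_of_eventuallyEq ?_
    filter_upwards [(isClosed_tsupport b).isOpen_compl.mem_nhds hp] with x hx
    rw [image_eq_zero_of_notMem_tsupport hx, zero_smul, map_zero]

variable [RiemannianBundle (fun x : M₁ ↦ TangentSpace I x)]
  [IsContMDiffRiemannianBundle I ∞ (EuclideanSpace ℝ (Fin d)) (fun x : M₁ ↦ TangentSpace I x)]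
  [RiemannianBundle (fun x : M₂ ↦ TangentSpace I x)]
  [IsContMDiffRiemannianBundle I ∞ (EuclideanSpace ℝ (Fin d)) (fun x : M₂ ↦ TangentSpace I x)]
  {o₁ : ManifoldOrientation I M₁} {o₂ : ManifoldOrientation I M₂}
  [T2Space M₁] [MeasurableSpace M₁] [BorelSpace M₁]

/-- The integrand is the divergence of (Cof df)* ξ, a C¹ field that vanishes wherever ξ does. -/
theorem integral_innerHom_cofDifferential [SecondCountableTopology M₁] (hd : d ≠ 0)
    (hf : IsLocalDiffeomorph I I 2 f) {ξ : ∀ x, TangentSpace I (f x)}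
    (hξ : IsTestSection I f ξ) :
    Integrable (fun x ↦ innerHom (cofDifferential o₁ o₂ f x) (covDerivAlong I f ξ x))
        (riemannianVolume I M₁) ∧
      ∫ x, innerHom (cofDifferential o₁ o₂ f x) (covDerivAlong I f ξ x)
        ∂(riemannianVolume I M₁) = 0 := by
  have hloc (p : M₁) := innerHom_cof_covDerivAlong (o₁ := o₁) (o₂ := o₂) hd hf
    (contDiffWithinAt_sectionCoord (hf.contMDiff.of_le one_le_two) hξ.contMDiff p)
  obtain ⟨K, hK, hKI, hK0⟩ := hξ.compactSupport
  simp_rw [fun p ↦ (hloc p).2]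
  refine integral_chartDiv (contMDiff_of_sectionCoord fun p ↦ (hloc p).1) hK hKI fun x hx ↦ ?_
  rw [cofField, hK0 x hx, map_zero]

/-- A continuous section along `f` that is orthogonal to all test sections vanishes. -/
theorem eq_zero_of_forall_integral_inner (hf : ContMDiff I I 1 f)
    {η : ∀ x, TangentSpace I (f x)}
    (hη : Continuous (fun x ↦ (⟨f x, η x⟩ : TangentBundle I M₂)))
    (h : ∀ σ : ∀ x, TangentSpace I (f x), IsTestSection I f σ →
      ∫ x, inner ℝ (σ x) (η x) ∂(riemannianVolume I M₁) = 0) (x : M₁) : η x = 0 := by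
  have hbundle : IsContinuousRiemannianBundle (EuclideanSpace ℝ (Fin d))
      (fun x : M₂ ↦ TangentSpace I x) := by
    obtain ⟨g, hg, hg'⟩ := IsContMDiffRiemannianBundle.exists_contMDiff (IB := I) (n := ∞)
      (F := EuclideanSpace ℝ (Fin d)) (E := fun x : M₂ ↦ TangentSpace I x)
    exact ⟨⟨g, hg.continuous, hg'⟩⟩
  have hint : ∀ q ∈ I.interior M₁, η q = 0 := by
    intro q hq
    by_contra hne
    -- Freezing the coordinates of η at q gives a section whose product with η is positive near q. A
    -- bump function supported there makes it a test section.
    set σ₀ : ∀ x, TangentSpace I (f x) := fun x ↦ coordField I (f q) (η q) (f x) with hσ₀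
    have hσq : σ₀ q = η q := coordFieldL_self (f q) (η q)
    have hσc : ContinuousAt (fun x ↦ (⟨f x, σ₀ x⟩ : TangentBundle I M₂)) q :=
      ((contMDiffAt_coordField (mem_chart_source H (f q)) (η q)).continuousAt).comp
        (f := f) hf.continuous.continuousAt
    have hic : ContinuousAt (fun x ↦ inner ℝ (σ₀ x) (η x)) q :=
      ContinuousAt.inner_bundle (F := EuclideanSpace ℝ (Fin d))
        (E := fun x : M₂ ↦ TangentSpace I x) hσc hη.continuousAt
    have hpos : 0 < inner ℝ (σ₀ q) (η q) := by
      rw [hσq]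
      exact real_inner_self_pos.2 hne
    have hU : {x | 0 < inner ℝ (σ₀ x) (η x) ∧ f x ∈ (chartAt H (f q)).source ∧
        x ∈ I.interior M₁} ∈ 𝓝 q := by
      filter_upwards [hic.eventually_const_lt hpos,
        hf.continuous.continuousAt.preimage_mem_nhds
          ((chartAt H (f q)).open_source.mem_nhds (mem_chart_source H (f q))),
        (I.isOpen_interior (M := M₁) (n := ∞) (by simp)).mem_nhds hq] with x h1 h2 h3
      exact ⟨h1, h2, h3⟩
    obtain ⟨b, -, hb⟩ := (SmoothBumpFunction.nhds_basis_tsupport (I := I) q).mem_iff.1 hU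
    have hσC := contMDiff_bump_smul_coordField hf b (fun x hx ↦ (hb hx).2.1) (η q)
    have htest : IsTestSection I f (fun x ↦ b x • σ₀ x) :=
      ⟨hσC, tsupport b, b.hasCompactSupport, fun x hx ↦ (hb hx).2.2, fun x hx ↦ by
        rw [image_eq_zero_of_notMem_tsupport hx, zero_smul]⟩
    refine (integral_pos_of_chart (I := I) (u := fun x ↦ inner ℝ (b x • σ₀ x) (η x))
      (Continuous.inner_bundle (F := EuclideanSpace ℝ (Fin d))
        (E := fun x : M₂ ↦ TangentSpace I x) hσC.continuous hη) (fun x ↦ ?_) hq ?_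
      (K := tsupport b) b.hasCompactSupport b.tsupport_subset_chartAt_source
      (fun x hx ↦ ?_)).ne' (h _ htest)
    · by_cases hx : x ∈ tsupport b
      · rw [real_inner_smul_left]
        exact mul_nonneg b.nonneg (hb hx).1.le
      · simp [image_eq_zero_of_notMem_tsupport hx]
    · simpa [b.eq_one] using hpos
    · simp [image_eq_zero_of_notMem_tsupport hx]
  -- It remains to pass to boundary points by continuity of η in coordinates.
  have hc : ContinuousAt (fun z ↦ (trivializationAt (EuclideanSpace ℝ (Fin d)) (TangentSpace I)
      (f x) (⟨f z, η z⟩ : TangentBundle I M₂)).2) x :=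
    ((FiberBundle.continuousAt_totalSpace _ _).1 hη.continuousAt).2
  have hcz : ContinuousAt (fun z ↦ coords I (f x) (f z) (η z)) x := by
    refine hc.congr ?_
    filter_upwards [hf.continuous.continuousAt.preimage_mem_nhds
      ((chartAt H (f x)).open_source.mem_nhds (mem_chart_source H (f x)))] with z hz
    exact (coords_apply hz _).symm
  have h0 : coords I (f x) (f x) (η x) ∈ closure {0} := by
    refine hcz.continuousWithinAt.mem_closure (s := I.interior M₁) (dense_interior x)
      fun z hz ↦ ?_
    exact (congrArg (coords I (f x) (f z)) (hint z hz)).trans (map_zero _)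
  rw [closure_singleton, Set.mem_singleton_iff, coords_self] at h0
  exact h0

end Weak

end RiemannianPiola

end

/-! ### The Riemannian Piola identity -/

open RiemannianPiola in
theorem mainTheorem1 (d : ℕ) [NeZero d]
    {M₁ : Type*} [TopologicalSpace M₁] [T2Space M₁] [SecondCountableTopology M₁]
    [MeasurableSpace M₁] [BorelSpace M₁]
    [ChartedSpace (EuclideanHalfSpace d) M₁] [IsManifold (𝓡∂ d) ∞ M₁]
    [RiemannianBundle (fun x : M₁ ↦ TangentSpace (𝓡∂ d) x)]
    [IsContMDiffRiemannianBundle (𝓡∂ d) ∞ (EuclideanSpace ℝ (Fin d))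
      (fun x : M₁ ↦ TangentSpace (𝓡∂ d) x)]
    (o₁ : ManifoldOrientation (𝓡∂ d) M₁)
    {M₂ : Type*} [TopologicalSpace M₂] [T2Space M₂] [SecondCountableTopology M₂]
    [ChartedSpace (EuclideanHalfSpace d) M₂] [IsManifold (𝓡∂ d) ∞ M₂]
    [RiemannianBundle (fun x : M₂ ↦ TangentSpace (𝓡∂ d) x)]
    [IsContMDiffRiemannianBundle (𝓡∂ d) ∞ (EuclideanSpace ℝ (Fin d))
      (fun x : M₂ ↦ TangentSpace (𝓡∂ d) x)]
    (o₂ : ManifoldOrientation (𝓡∂ d) M₂)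
    (f : M₁ → M₂) (hf : IsLocalDiffeomorph (𝓡∂ d) (𝓡∂ d) 2 f) :
    (∀ p : M₁, coderivative (𝓡∂ d) f (cofDifferential o₁ o₂ f) p = 0) ∧
    (∀ η : ∀ x, TangentSpace (𝓡∂ d) (f x),
      Continuous (fun x ↦ (⟨f x, η x⟩ : TangentBundle (𝓡∂ d) M₂)) →
      (IsAdjointCoderivative (𝓡∂ d) f (cofDifferential o₁ o₂ f) η ↔ ∀ x, η x = 0)) ∧
    (∀ ξ : ∀ x, TangentSpace (𝓡∂ d) (f x), IsTestSection (𝓡∂ d) f ξ →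
      Integrable (fun x ↦ innerHom (cofDifferential o₁ o₂ f x) (covDerivAlong (𝓡∂ d) f ξ x))
        (riemannianVolume (𝓡∂ d) M₁) ∧
      ∫ x, innerHom (cofDifferential o₁ o₂ f x) (covDerivAlong (𝓡∂ d) f ξ x)
        ∂(riemannianVolume (𝓡∂ d) M₁) = 0) := by
  have hd : d ≠ 0 := NeZero.ne d
  have hweak : ∀ ξ : ∀ x, TangentSpace (𝓡∂ d) (f x), IsTestSection (𝓡∂ d) f ξ → _ := fun ξ hξ ↦
    integral_innerHom_cofDifferential (o₁ := o₁) (o₂ := o₂) hd hf hξ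
  refine ⟨coderivative_cofDifferential hd hf, fun η hη ↦ ⟨fun h ↦ ?_, fun h σ hσ ↦ ?_⟩, hweak⟩
  -- The adjoint relation equates ∫⟨σ, η⟩ with ∫⟨∇σ, Cof df⟩, which is zero by the weak identity.
  · refine eq_zero_of_forall_integral_inner (hf.contMDiff.of_le one_le_two) hη fun σ hσ ↦ ?_
    rw [h σ hσ]
    simp_rw [innerHom_comm (covDerivAlong (𝓡∂ d) f σ _)]
    exact (hweak σ hσ).2
  · simp_rw [h, inner_zero_right, integral_zero, innerHom_comm (covDerivAlong (𝓡∂ d) f σ _)]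
    exact (hweak σ hσ).2.symm
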